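/- Consider deterministic algorithms on an asynchronous clique of $n$ nodes with distinct IDs from $\mathbb{N}$. Initially a node knows only $n$ and its own ID. It addresses the other nodes through $n-1$ ports, whose assignment is arbitrary (chosen by an adversary). Links deliver messages in FIFO order, the adversary chooses the delay of every message, which is at most one unit of time, and local computation takes no time. An adversary spontaneously wakes up an arbitrary nonempty set of nodes at arbitrary times; a sleeping node is also woken up by receiving a message. There exist a deterministic leader election algorithm and a constant $C$ such that for every $n\ge 1$, every assignment of distinct IDs, every port assignment, and every behaviour of the adversary: 1. the execution is finite, every node irrevocably outputs an ID, and all nodes output the ID of one and the same node of the network (the leader); 2. the last message is received at most $C\log n$ units of time after the last spontaneous wake-up of a node (in particular, if all nodes wake up simultaneously, the running time is at most $C\log n$); 3. at most $C\,n\log n$ messages are sent in total; 4. if all IDs are smaller than $N$, every message has at most $C\log N$ bits (so for IDs polynomial in $n$, messages have $O(\log n)$ bits). -/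

import Mathlib

/-! Deterministic message-passing algorithms on an asynchronous clique of `n` nodes. -/

namespace AsyncClique

/-- A port mapping of the clique on `Fin n`. Every node has `n - 1` ports, and `toFun (u, i) = (v, j)`
means that what `u` sends over its port `i` is received by `v` over its port `j`. Links are
bidirectional, and the ports of `u` lead to pairwise distinct nodes other than `u`
(hence to all other nodes). -/
structure PortMapping (n : ℕ) where
  toFun : Fin n × Fin (n - 1) → Fin n × Fin (n - 1)
  involutive : Function.Involutive toFun
  no_loop : ∀ u i, (toFun (u, i)).1 ≠ u
  clique : ∀ u, Function.Injective fun i => (toFun (u, i)).1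

/-- A deterministic algorithm for networks of `n` nodes: the program run by every node. A node
initially knows only `n` and its own ID. It acts when it is woken up spontaneously (`wake`) or
when it receives a message over one of its ports (`recv`; a sleeping node is woken up by this).
An action yields the new state and a list of messages, each with the port over which it is sent.
Messages are natural numbers, read as bit strings. `output` is the ID that the node has output
as the ID of the leader, if it has decided already. -/
structure Algorithm (n : ℕ) where
  State : Type
  init : (id : ℕ) → State
  wake : State → State × List (Fin (n - 1) × ℕ)
  recv : State → Fin (n - 1) → ℕ → State × List (Fin (n - 1) × ℕ)
  output : State → Option ℕ

/-- A global configuration of the network, together with the quantities that are measured. -/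
structure Config {n : ℕ} (A : Algorithm n) where
  /-- local states -/
  state : Fin n → A.State
  /-- which nodes are awake -/
  awake : Fin n → Bool
  /-- `transit u i`: the messages sent by `u` over its port `i` and not yet received, oldest first,
  each with the time at which it was sent -/
  transit : Fin n → Fin (n - 1) → List (ℕ × ℝ)
  /-- the number of messages sent so far -/
  sent : ℕ
  /-- the time of the latest event (wake-up or receipt of a message) -/
  now : ℝ
  /-- the time of the latest spontaneous wake-up -/
  lastWake : ℝ

section

variable {n : ℕ} {A : Algorithm n}

/-- All nodes asleep, no message sent. -/
noncomputable def Config.initial (A : Algorithm n) (ids : Fin n → ℕ) : Config A where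
  state u := A.init (ids u)
  awake _ := false
  transit _ _ := []
  sent := 0
  now := 0
  lastWake := 0

/-- At time `t`, node `u` performs the action with result `r` (new state, messages to send). -/
def Config.act (c : Config A) (t : ℝ) (u : Fin n)
    (r : A.State × List (Fin (n - 1) × ℕ)) : Config A where
  state := Function.update c.state u r.1
  awake := Function.update c.awake u true
  transit v i := c.transit v i ++
    if v = u then (r.2.filter fun x => x.1 = i).map fun x => (x.2, t) else []
  sent := c.sent + r.2.length
  now := t
  lastWake := c.lastWake

/-- Remove the messages in transit from `u` over port `i`, except for those in `rest`. -/
def Config.setTransit (c : Config A) (u : Fin n) (i : Fin (n - 1)) (rest : List (ℕ × ℝ)) :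
    Config A :=
  { c with transit := fun v k => if v = u ∧ k = i then rest else c.transit v k }

/-- The next event may happen at time `t`: time does not run backwards, and no message in transit
has been under way for more than one unit of time. -/
def Config.MayAdvance (c : Config A) (t : ℝ) : Prop :=
  c.now ≤ t ∧ ∀ u i, ∀ x ∈ c.transit u i, t ≤ x.2 + 1

/-- One event, chosen by the adversary together with its time `t`: the spontaneous wake-up of a
sleeping node, or the receipt of the oldest message in transit in one direction of a link
(links are FIFO). -/
inductive Step (p : PortMapping n) : Config A → Config A → Prop
  | wake (c : Config A) (t : ℝ) (u : Fin n) (ht : c.MayAdvance t) (hu : c.awake u = false) :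
      Step p c { c.act t u (A.wake (c.state u)) with lastWake := t }
  | deliver (c : Config A) (t : ℝ) (u : Fin n) (i : Fin (n - 1)) (m : ℕ) (s : ℝ)
      (rest : List (ℕ × ℝ)) (ht : c.MayAdvance t) (hm : c.transit u i = (m, s) :: rest) :
      Step p c ((c.setTransit u i rest).act t (p.toFun (u, i)).1
        (A.recv (c.state (p.toFun (u, i)).1) (p.toFun (u, i)).2 m))

/-- `c` is reached by some (finite prefix of an) execution. -/
def Reachable (ids : Fin n → ℕ) (p : PortMapping n) (c : Config A) : Prop :=
  Relation.ReflTransGen (Step p) (Config.initial A ids) c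

/-- The execution has started, and no message is in transit. -/
def Config.Quiescent (c : Config A) : Prop :=
  (∃ u, c.awake u = true) ∧ ∀ u i, c.transit u i = []

/-- The algorithm solves (explicit) leader election, whatever the adversary does: every execution
is finite, outputs are irrevocable, and when no more messages are in transit, all nodes (awake or
not before) have output the ID of one and the same node of the network. -/
def ElectsLeader (A : Algorithm n) (ids : Fin n → ℕ) (p : PortMapping n) : Prop :=
  (¬ ∃ e : ℕ → Config A, e 0 = Config.initial A ids ∧ ∀ k, Step p (e k) (e (k + 1))) ∧
  (∀ c c' : Config A, Reachable ids p c → Step p c c' →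
    ∀ u l, A.output (c.state u) = some l → A.output (c'.state u) = some l) ∧
  (∀ c : Config A, Reachable ids p c → c.Quiescent →
    ∃ w : Fin n, ∀ u, A.output (c.state u) = some (ids w))

/-- In every execution at most `M` messages are sent. -/
def MessagesAtMost (A : Algorithm n) (ids : Fin n → ℕ) (p : PortMapping n) (M : ℝ) : Prop :=
  ∀ c : Config A, Reachable ids p c → (c.sent : ℝ) ≤ M

/-- In every execution, the last message is received at most `T` units of time after the last
spontaneous wake-up. (An execution prefix may always be continued without further spontaneous
wake-ups, so this is a condition on all reachable configurations. If all nodes wake up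
simultaneously at time `0`, then `lastWake = 0`, and `T` bounds the running time.) -/
def TimeAtMost (A : Algorithm n) (ids : Fin n → ℕ) (p : PortMapping n) (T : ℝ) : Prop :=
  ∀ c : Config A, Reachable ids p c → c.now ≤ c.lastWake + T

/-- In every execution, every message that is sent has at most `B` bits. -/
def MessageBitsAtMost (A : Algorithm n) (ids : Fin n → ℕ) (p : PortMapping n) (B : ℝ) : Prop :=
  ∀ c : Config A, Reachable ids p c → ∀ u i, ∀ x ∈ c.transit u i, (Nat.size x.1 : ℝ) ≤ B

end

end AsyncClique

/-! A node woken spontaneously becomes a candidate with priority (level, ID), unless it is the only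
node and wins at once. Candidates ask for ports in blocks of doubling size: at level `l` exactly the
ports `k` with `Nat.size k < l`, that is `k < 2 ^ (l - 1)` for `l ≥ 1`, have been asked. A node
without owner yields to any priority above its own. A captured node first has its owner asked, and
changes hands only after the owner has confirmed that it is smaller and has stopped. A stopped
candidate never moves up again, so its priority is frozen.

Safety and message count: when a node changes hands, all its former owners are stopped below the
priority of the new one (`Safe.lost`). Hence of two candidates that captured the same node, one is
stopped at a level not above that at which the other asked (`Safe.exclusive`). So the candidates
that reach the block of port `k` have captured pairwise disjoint sets of at least `(k + 1) / 2`
nodes (for `k > 0`), and there are at most `2 * n / (k + 1)` of them (`Safe.card_level`). A request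
costs at most four messages (request, query, release, grant); summing over `k` gives a harmonic sum,
and the winner adds `n - 1` announcements. A winner has captured, and thereby stopped, all other
nodes, so it is unique.

Liveness: an open request is always represented by a message in transit, or has met a larger
priority (`Pursued`). In a quiescent configuration without winner, the node of largest priority is
not stopped and has an open request of that same priority, a contradiction (`Reachable.elected`).

Time: a level takes at most four units, one per message of the exchange, and there are about `log₂
n` levels (`sendTime`). Termination follows from the message bound, since every event is a wake-up
or consumes a message. -/

namespace AsyncClique

/-! ### The algorithm -/

/-- Priorities of candidates: pairs of a level and an ID, ordered lexicographically. -/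
abbrev Key := ℕ ×ₗ ℕ

/-- The messages of the algorithm. -/
inductive Msg
  /-- a candidate asks to capture the receiver -/
  | request (q : Key)
  /-- a node asks its owner to give way to a candidate of priority `q` -/
  | query (q : Key)
  /-- the owner gives way to the candidate of priority `q` -/
  | release (q : Key)
  /-- the sender is captured by the receiver -/
  | grant
  /-- the ID of the leader -/
  | leader (id : ℕ)

/-- Messages as natural numbers. -/
def Msg.encode : Msg → ℕ
  | request q => Nat.pair 0 (Nat.pair (ofLex q).1 (ofLex q).2)
  | query q => Nat.pair 1 (Nat.pair (ofLex q).1 (ofLex q).2)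
  | release q => Nat.pair 2 (Nat.pair (ofLex q).1 (ofLex q).2)
  | grant => Nat.pair 3 0
  | leader id => Nat.pair 4 id

/-- The inverse of `Msg.encode`. -/
def Msg.decode (m : ℕ) : Msg :=
  match m.unpair.1 with
  | 0 => request (toLex m.unpair.2.unpair)
  | 1 => query (toLex m.unpair.2.unpair)
  | 2 => release (toLex m.unpair.2.unpair)
  | 3 => grant
  | _ => leader m.unpair.2

@[simp] theorem Msg.decode_encode (x : Msg) : Msg.decode x.encode = x := by
  cases x <;> simp [Msg.encode, Msg.decode]

/-- The state of a node. A node is a candidate if its level is positive. -/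
structure NodeState (n : ℕ) where
  id : ℕ
  level : ℕ
  /-- the node has been beaten by another candidate -/
  dead : Bool
  won : Bool
  /-- the ports to the nodes captured by this one -/
  got : Finset (Fin (n - 1))
  /-- the largest priority of a request that was not ignored -/
  maxReq : Key
  /-- the port over which the request of priority `maxReq` came, while the owner is asked -/
  pending : Option (Fin (n - 1))
  /-- the port to the candidate that captured this node last -/
  owner : Option (Fin (n - 1))
  /-- the ports to the candidates that captured this node at some time -/
  granted : Finset (Fin (n - 1))
  output : Option ℕ

namespace NodeState

variable {n : ℕ}

/-- The state of a sleeping node. -/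
def start (n id : ℕ) : NodeState n where
  id := id
  level := 0
  dead := false
  won := false
  got := ∅
  maxReq := toLex (0, 0)
  pending := none
  owner := none
  granted := ∅
  output := none

/-- The priority of a node. -/
def key (s : NodeState n) : Key := toLex (s.level, s.id)

/-- The state of a node that becomes the leader. -/
def win (s : NodeState n) : NodeState n :=
  { s with won := true, output := s.output <|> some s.id }

/-- The messages sent by a node that becomes the leader. -/
def announcements (s : NodeState n) : List (Fin (n - 1) × Msg) :=
  (List.finRange (n - 1)).map fun k => (k, .leader s.id)

/-- The messages sent by a candidate that moves to the next level. -/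
def requests (s : NodeState n) : List (Fin (n - 1) × Msg) :=
  ((List.finRange (n - 1)).filter fun k : Fin (n - 1) => Nat.size k.val = s.level).map
    fun k => (k, .request (toLex (s.level + 1, s.id)))

/-- A node that has captured all nodes asked so far becomes the leader if these are all nodes.
Otherwise it moves to the next level and sends requests to further nodes. -/
def advance (s : NodeState n) : NodeState n × List (Fin (n - 1) × Msg) :=
  if ∀ k, k ∈ s.got then (s.win, s.announcements)
  else ({ s with level := s.level + 1 }, s.requests)

/-- The reaction to a message. -/
def react (s : NodeState n) (j : Fin (n - 1)) : Msg → NodeState n × List (Fin (n - 1) × Msg)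
  | .request q =>
    if q < s.maxReq then (s, []) else
    match s.owner with
    | none => if q ≤ s.key then (s, []) else
      ({ s with
          maxReq := q, dead := true, pending := none, owner := some j,
          granted := insert j s.granted },
        [(j, .grant)])
    | some i => if i = j then (s, [(j, .grant)]) else
      ({ s with maxReq := q, pending := some j }, [(i, .query q)])
  | .query q => if q ≤ s.key then (s, []) else ({ s with dead := true }, [(j, .release q)])
  | .release q =>
    match s.pending with
    | none => (s, [])
    | some i => if s.owner = some j ∧ s.maxReq = q then
      ({ s with pending := none, owner := some i, granted := insert i s.granted }, [(i, .grant)])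
      else (s, [])
  | .grant =>
    let s' := { s with got := insert j s.got }
    if s.dead ∨ s.won ∨ ∃ k : Fin (n - 1), Nat.size k < s.level ∧ k ∉ s'.got then (s', [])
    else s'.advance
  | .leader id => ({ s with output := s.output <|> some id }, [])

/-- The possible reactions to a message, as a relation. -/
inductive Reacts (s : NodeState n) (j : Fin (n - 1)) :
    Msg → NodeState n → List (Fin (n - 1) × Msg) → Prop
  | outbid (q) (h : q < s.maxReq) : Reacts s j (.request q) s []
  | selfOutbid (q) (h : q ≤ s.key) (ho : s.owner = none) : Reacts s j (.request q) s []
  | capture (q) (hm : s.maxReq ≤ q) (h : s.key < q) (ho : s.owner = none) :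
      Reacts s j (.request q)
        { s with
          maxReq := q, dead := true, pending := none, owner := some j,
          granted := insert j s.granted }
        [(j, .grant)]
  | again (q) (ho : s.owner = some j) : Reacts s j (.request q) s [(j, .grant)]
  | ask (q) (i) (hm : s.maxReq ≤ q) (ho : s.owner = some i) (hij : i ≠ j) :
      Reacts s j (.request q) { s with maxReq := q, pending := some j } [(i, .query q)]
  | stay (q) (h : q ≤ s.key) : Reacts s j (.query q) s []
  | release (q) (h : s.key < q) : Reacts s j (.query q) { s with dead := true } [(j, .release q)]
  | stale (q) (h : s.owner = some j → s.maxReq = q → s.pending = none) :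
      Reacts s j (.release q) s []
  | recapture (q) (i) (ho : s.owner = some j) (hm : s.maxReq = q) (hp : s.pending = some i) :
      Reacts s j (.release q)
        { s with pending := none, owner := some i, granted := insert i s.granted } [(i, .grant)]
  | wait (h : s.dead = true ∨ s.won = true ∨
      ∃ k : Fin (n - 1), Nat.size k < s.level ∧ k ∉ insert j s.got) :
      Reacts s j .grant { s with got := insert j s.got } []
  | win (hd : s.dead = false) (hw : s.won = false) (h : ∀ k, k ∈ insert j s.got) :
      Reacts s j .grant { s with got := insert j s.got }.win s.announcements
  | levelUp (hd : s.dead = false) (hw : s.won = false)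
      (hl : ∀ k : Fin (n - 1), Nat.size k < s.level → k ∈ insert j s.got)
      (h : ∃ k, k ∉ insert j s.got) :
      Reacts s j .grant { s with got := insert j s.got, level := s.level + 1 } s.requests
  | hear (id) : Reacts s j (.leader id) { s with output := s.output <|> some id } []

/-- Turns the nested conditionals of `react` into a flat case distinction, on which the proofs of
the invariants split. -/
theorem reacts (s : NodeState n) (j : Fin (n - 1)) (x : Msg) :
    Reacts s j x (s.react j x).1 (s.react j x).2 := by
  cases x with
  | request q =>
    unfold react
    by_cases h : q < s.maxReq
    · simpa [h] using .outbid q h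
    · simp only [h, if_false]
      cases ho : s.owner with
      | none =>
        by_cases h' : q ≤ s.key
        · simpa [h'] using .selfOutbid q h' ho
        · simpa [h'] using .capture q (not_lt.1 h) (not_le.1 h') ho
      | some i =>
        by_cases h' : i = j
        · subst h'; simpa using .again q ho
        · simpa [h', ho] using Reacts.ask (s := s) (j := j) q i (not_lt.1 h) ho h'
  | query q =>
    unfold react
    by_cases h : q ≤ s.key
    · simpa [h] using .stay q h
    · simpa [h] using .release q (not_le.1 h)
  | release q =>
    unfold react
    cases hp : s.pending with
    | none => simpa using .stale q fun _ _ => hp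
    | some i =>
      by_cases h : s.owner = some j ∧ s.maxReq = q
      · simpa [h] using Reacts.recapture (s := s) (j := j) q i h.1 h.2 hp
      · simpa [h] using .stale q fun h1 h2 => (h ⟨h1, h2⟩).elim
  | grant =>
    unfold react
    by_cases h : s.dead = true ∨ s.won = true ∨
      ∃ k : Fin (n - 1), Nat.size k < s.level ∧ k ∉ insert j s.got
    · simp only [h, if_true]; exact .wait h
    · simp only [h, if_false]
      push Not at h
      unfold advance
      by_cases h' : ∀ k, k ∈ insert j s.got
      · simp only [h', implies_true, if_true]
        exact .win (by simpa using h.1) (by simpa using h.2.1) h'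
      · simp only [h', if_false]
        exact .levelUp (by simpa using h.1) (by simpa using h.2.1) h.2.2 (by simpa using h')
  | leader id => exact .hear id

end NodeState

/-- The encoding of a list of messages to be sent. -/
def encodeAll {n : ℕ} (r : NodeState n × List (Fin (n - 1) × Msg)) :
    NodeState n × List (Fin (n - 1) × ℕ) :=
  (r.1, r.2.map fun x => (x.1, x.2.encode))

/-- The leader election algorithm: a candidate of level `l` has requested the nodes at the ports
`k` with `Nat.size k < l`, and moves on when it has captured them all. A node gives itself away
to a candidate of larger priority only when its former owner has been stopped by that priority. -/
def captureElection (n : ℕ) : Algorithm n where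
  State := NodeState n
  init id := NodeState.start n id
  wake s := encodeAll s.advance
  recv s j m := encodeAll (s.react j (Msg.decode m))
  output s := s.output

/-! ### The steps of an execution -/

section Steps

variable {n : ℕ}

/-- The local state of a node. -/
def Config.node (c : Config (captureElection n)) (u : Fin n) : NodeState n := c.state u

/-- The message `x`, sent at time `s` by `u` over port `i`, is in transit. -/
def Config.InTransit (c : Config (captureElection n)) (u : Fin n) (i : Fin (n - 1)) (x : Msg)
    (s : ℝ) : Prop :=
  (x.encode, s) ∈ c.transit u i

theorem Msg.encode_injective : Function.Injective Msg.encode :=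
  Function.LeftInverse.injective Msg.decode_encode

/-- Node `v` changes its state to `st` and sends `ms` at time `t`; the messages in `del` are
delivered. -/
structure Change (c c' : Config (captureElection n)) (v : Fin n) (t : ℝ) (st : NodeState n)
    (ms : List (Fin (n - 1) × Msg)) (del : Fin n → Fin (n - 1) → Msg → ℝ → Prop) : Prop where
  node_eq : c'.node v = st
  node_ne : ∀ w, w ≠ v → c'.node w = c.node w
  awake_eq : c'.awake v = true
  awake_ne : ∀ w, w ≠ v → c'.awake w = c.awake w
  now_eq : c'.now = t
  now_le : c.now ≤ t
  wake_le : c.lastWake ≤ c'.lastWake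
  transit_or : ∀ w k x s, c'.InTransit w k x s →
    c.InTransit w k x s ∨ (w = v ∧ s = t ∧ (k, x) ∈ ms)
  transit_new : ∀ k x, (k, x) ∈ ms → c'.InTransit v k x t
  transit_old : ∀ w k x s, c.InTransit w k x s → c'.InTransit w k x s ∨ del w k x s

/-- All messages in transit are encodings. -/
def Config.Encoded (c : Config (captureElection n)) : Prop :=
  ∀ u i, ∀ y ∈ c.transit u i, ∃ x : Msg, x.encode = y.1

/-- The steps of the algorithm. -/
inductive Event (p : PortMapping n) (c c' : Config (captureElection n)) : Prop
  | win (v : Fin n) (t : ℝ) (hv : c.awake v = false) (hg : ∀ k, k ∈ (c.node v).got)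
      (hc : Change c c' v t (c.node v).win (c.node v).announcements
        fun _ _ _ _ => False) (ht : c'.lastWake = t)
  | start (v : Fin n) (t : ℝ) (hv : c.awake v = false) (hg : ∃ k, k ∉ (c.node v).got)
      (hc : Change c c' v t { c.node v with level := (c.node v).level + 1 } (c.node v).requests
        fun _ _ _ _ => False) (ht : c'.lastWake = t)
  | receive (u : Fin n) (i : Fin (n - 1)) (v : Fin n) (j : Fin (n - 1)) (x : Msg) (s t : ℝ)
      (st : NodeState n) (ms : List (Fin (n - 1) × Msg))
      (hp : p.toFun (u, i) = (v, j)) (hx : c.InTransit u i x s) (ht : t ≤ s + 1)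
      (hr : NodeState.Reacts (c.node v) j x st ms)
      (hc : Change c c' v t st ms fun w k y s' => w = u ∧ k = i ∧ y = x ∧ s' = s)

theorem mem_transit_act {c : Config (captureElection n)} {t : ℝ} {v : Fin n}
    {r : NodeState n × List (Fin (n - 1) × Msg)} {w : Fin n} {k : Fin (n - 1)} {y : ℕ × ℝ} :
    y ∈ (c.act t v (encodeAll r)).transit w k ↔
      y ∈ c.transit w k ∨ (w = v ∧ y.2 = t ∧ ∃ x : Msg, (k, x) ∈ r.2 ∧ x.encode = y.1) := by
  obtain ⟨m, s⟩ := y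
  by_cases h : w = v
  · subst h
    simp only [Config.act, encodeAll, if_true, List.mem_append, List.mem_map, List.mem_filter]
    constructor
    · rintro (h | ⟨⟨k', m'⟩, ⟨⟨⟨a, b⟩, h1, h2⟩, h3⟩, h4⟩)
      · exact .inl h
      · simp at h2 h3 h4
        obtain ⟨rfl, rfl⟩ := h2
        subst h3
        exact .inr ⟨trivial, h4.2.symm, b, h1, h4.1⟩
    · rintro (h | ⟨-, h1, x, h2, h3⟩)
      · exact .inl h
      · refine .inr ⟨(k, m), ⟨⟨(k, x), h2, by simpa using h3⟩, by simp⟩, by simp [← h1]⟩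
  · simp [Config.act, encodeAll, h]

theorem Step.encoded {p : PortMapping n} {c c' : Config (captureElection n)} (h : Step p c c')
    (he : c.Encoded) : c'.Encoded := by
  intro w k y hy
  cases h with
  | wake t v ht hv =>
    rcases mem_transit_act.1 hy with h | ⟨-, -, x, -, h⟩
    · exact he _ _ _ h
    · exact ⟨x, h⟩
  | deliver t u i m s rest ht hm =>
    rcases mem_transit_act.1 hy with h | ⟨-, -, x, -, h⟩
    · simp only [Config.setTransit] at h
      split_ifs at h with h'
      · obtain ⟨rfl, rfl⟩ := h'
        exact he w k y (by rw [hm]; exact List.mem_cons_of_mem _ h)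
      · exact he _ _ _ h
    · exact ⟨x, h⟩

/-- The invariants need only know which messages are in transit, so `Event` forgets their order.
`Encoded` lets a delivered number be read as a message, and `c.lastWake ≤ c.now` makes `lastWake`
monotone. -/
theorem Step.event {p : PortMapping n} {c c' : Config (captureElection n)} (h : Step p c c')
    (he : c.Encoded) (hl : c.lastWake ≤ c.now) : Event p c c' := by
  cases h with
  | wake t v ht hv =>
    have key : ∀ st ms, (c.node v).advance = (st, ms) →
        Change c { c.act t v (encodeAll (c.node v).advance) with lastWake := t } v t st ms
          fun _ _ _ _ => False := by
      intro st ms hr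
      obtain rfl : (c.node v).advance.1 = st := by rw [hr]
      obtain rfl : (c.node v).advance.2 = ms := by rw [hr]
      refine ⟨?_, ?_, ?_, ?_, rfl, ht.1, hl.trans ht.1, ?_, ?_, ?_⟩
      · exact Function.update_self _ _ _
      · intro w hw; exact Function.update_of_ne hw _ _
      · simp [Config.act]
      · intro w hw; simp [Config.act, hw]
      · intro w k x s hx
        rcases mem_transit_act.1 hx with h | ⟨h1, h2, y, h3, h4⟩
        · exact .inl h
        · exact .inr ⟨h1, h2, Msg.encode_injective h4 ▸ h3⟩
      · intro k x hx
        exact mem_transit_act.2 (.inr ⟨rfl, rfl, x, hx, rfl⟩)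
      · intro w k x s hx
        exact .inl (mem_transit_act.2 (.inl hx))
    by_cases hg : ∀ k, k ∈ (c.node v).got
    · refine .win v t hv hg (key _ _ (if_pos hg)) rfl
    · refine .start v t hv (by simpa using hg) (key _ _ (if_neg hg)) rfl
  | deliver t u i m s rest ht hm =>
    obtain ⟨x, rfl⟩ := he u i (m, s) (by simp [hm])
    refine .receive u i (p.toFun (u, i)).1 (p.toFun (u, i)).2 x s t _ _ rfl
      (by simp [Config.InTransit, hm]) (ht.2 u i _ (by rw [hm]; exact List.mem_cons_self))
      (NodeState.reacts _ _ x) ⟨?_, ?_, ?_, ?_, rfl, ht.1, le_rfl, ?_, ?_, ?_⟩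
    · refine (Function.update_self _ _ _).trans ?_
      simp only [captureElection, Msg.decode_encode, encodeAll]
      rfl
    · intro w hw; exact Function.update_of_ne hw _ _
    · simp [Config.act]
    · intro w hw; simp [Config.act, hw, Config.setTransit]
    · intro w k y s' hy
      simp only [captureElection, Msg.decode_encode] at hy
      rcases mem_transit_act.1 hy with h | ⟨h1, h2, z, h3, h4⟩
      · left
        simp only [Config.setTransit] at h
        split_ifs at h with h'
        · obtain ⟨rfl, rfl⟩ := h'
          show _ ∈ c.transit w k
          rw [hm]; exact List.mem_cons_of_mem _ h
        · exact h
      · exact .inr ⟨h1, h2, Msg.encode_injective h4 ▸ h3⟩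
    · intro k y hy
      simp only [captureElection, Msg.decode_encode]
      exact mem_transit_act.2 (.inr ⟨rfl, rfl, y, hy, rfl⟩)
    · intro w k y s' hy
      by_cases h : w = u ∧ k = i
      · obtain ⟨rfl, rfl⟩ := h
        have hy' : (y.encode, s') ∈ c.transit w k := hy
        rw [hm] at hy'
        rcases List.mem_cons.1 hy' with h | h
        · right
          simp only [Prod.mk.injEq] at h
          exact ⟨rfl, rfl, Msg.encode_injective h.1, h.2⟩
        · left
          simp only [captureElection, Msg.decode_encode]
          refine mem_transit_act.2 (.inl ?_)
          simpa [Config.setTransit] using h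
      · left
        simp only [captureElection, Msg.decode_encode]
        refine mem_transit_act.2 (.inl ?_)
        simpa [Config.setTransit, h] using show _ ∈ c.transit w k from hy

theorem Reachable.encoded {ids : Fin n → ℕ} {p : PortMapping n}
    {c : Config (captureElection n)} (hc : Reachable ids p c) : c.Encoded := by
  induction hc with
  | refl => exact fun u i y hy => by simp [Config.initial] at hy
  | tail _ hs ih => exact hs.encoded ih

theorem Reachable.lastWake_le {ids : Fin n → ℕ} {p : PortMapping n}
    {c : Config (captureElection n)} (hc : Reachable ids p c) : c.lastWake ≤ c.now := by
  induction hc with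
  | refl => exact le_rfl
  | tail _ hs ih =>
    cases hs with
    | wake t v ht hv => exact le_rfl
    | deliver t u i m s rest ht hm => exact ih.trans ht.1

/-- A property of configurations that holds initially and is preserved by all events holds in all
reachable configurations. -/
theorem Reachable.invariant {ids : Fin n → ℕ} {p : PortMapping n}
    {I : Config (captureElection n) → Prop} (h0 : I (Config.initial _ ids))
    (hI : ∀ c c' : Config (captureElection n), Reachable ids p c → Event p c c' → I c → I c')
    {c : Config (captureElection n)} (hc : Reachable ids p c) : I c := by
  induction hc with
  | refl => exact h0
  | tail hb hs ih =>
    exact hI _ _ hb (hs.event (Reachable.encoded hb) (Reachable.lastWake_le hb)) ih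

end Steps

end AsyncClique

namespace AsyncClique

/-! ### Safety -/

section Safety

variable {n : ℕ}

/-- The changes that the state of a node can undergo. -/
structure NodeState.Grows (s s' : NodeState n) : Prop where
  id : s'.id = s.id
  level : s.level ≤ s'.level
  dead : s.dead = true → s'.dead = true
  -- The frozen level of a stopped candidate makes upper bounds on its priority permanent.
  level_eq : s.dead = true → s'.level = s.level
  won : s.won = true → s'.won = true
  got : s.got ⊆ s'.got
  granted : s.granted ⊆ s'.granted
  output : ∀ x, s.output = some x → s'.output = some x
  maxReq : s.maxReq ≤ s'.maxReq

theorem NodeState.Grows.refl (s : NodeState n) : s.Grows s := by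
  constructor <;> simp

theorem NodeState.Grows.key {s s' : NodeState n} (h : s.Grows s') : s.key ≤ s'.key := by
  have := h.id
  have := h.level
  simp only [NodeState.key, Prod.Lex.toLex_le_toLex]
  omega

theorem NodeState.Grows.key_eq {s s' : NodeState n} (h : s.Grows s') (hd : s.dead = true) :
    s'.key = s.key := by
  simp only [NodeState.key, h.id, h.level_eq hd]

theorem NodeState.Reacts.grows {s s' : NodeState n} {j : Fin (n - 1)} {x : Msg}
    {ms : List (Fin (n - 1) × Msg)} (h : s.Reacts j x s' ms) : s.Grows s' := by
  cases h <;> constructor <;> simp_all [NodeState.win]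

theorem NodeState.grows_win (s : NodeState n) : s.Grows s.win := by
  constructor <;> simp_all [NodeState.win]

/-- A wake-up raises the level, which is compatible with `level_eq` only because sleeping nodes are
not stopped. -/
theorem Event.grows {p : PortMapping n} {c c' : Config (captureElection n)} (e : Event p c c')
    (hs : ∀ v, c.awake v = false → (c.node v).dead = false) (w : Fin n) :
    (c.node w).Grows (c'.node w) := by
  rcases e with ⟨v, t, hv, hg, hc, -⟩ | ⟨v, t, hv, hg, hc, -⟩ |
    ⟨u, i, v, j, x, s, t, st, ms, hp, hx, ht, hr, hc⟩
  all_goals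
    by_cases h : w = v
    swap
    · rw [hc.node_ne w h]; exact .refl _
    subst h
    rw [hc.node_eq]
  · exact NodeState.grows_win _
  · have := hs w hv
    constructor <;> simp_all
  · exact hr.grows

theorem PortMapping.symm (p : PortMapping n) {u v : Fin n} {i j : Fin (n - 1)}
    (h : p.toFun (u, i) = (v, j)) : p.toFun (v, j) = (u, i) := by
  rw [← h, p.involutive]

theorem PortMapping.ne (p : PortMapping n) {u v : Fin n} {i j : Fin (n - 1)}
    (h : p.toFun (u, i) = (v, j)) : v ≠ u := by
  have := p.no_loop u i
  rwa [h] at this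

/-- Distinct ports lead to distinct nodes. -/
theorem PortMapping.node_ne (p : PortMapping n) {v a b : Fin n} {i j k l : Fin (n - 1)}
    (h : p.toFun (v, i) = (a, k)) (h' : p.toFun (v, j) = (b, l)) (hij : i ≠ j) : a ≠ b := by
  rintro rfl
  exact hij (p.clique v (by simp [h, h']))

/-- Every node other than `v` is reached over some port of `v`. -/
theorem PortMapping.exists_port (p : PortMapping n) {v w : Fin n} (h : w ≠ v) :
    ∃ i j, p.toFun (v, i) = (w, j) := by
  classical
  have hn : (Finset.univ.image fun i => (p.toFun (v, i)).1) = Finset.univ.erase v := by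
    apply Finset.eq_of_subset_of_card_le
    · intro x hx
      obtain ⟨i, -, rfl⟩ := Finset.mem_image.1 hx
      simpa using p.no_loop v i
    · rw [Finset.card_image_of_injective _ (p.clique v)]
      simp
  have : w ∈ Finset.univ.image fun i => (p.toFun (v, i)).1 := by rw [hn]; simpa using h
  obtain ⟨i, -, rfl⟩ := Finset.mem_image.1 this
  exact ⟨i, _, rfl⟩

/-- The priority of the request sent by `u` over port `i`. -/
def requestKey (ids : Fin n → ℕ) (u : Fin n) (i : Fin (n - 1)) : Key :=
  toLex (Nat.size i + 1, ids u)

/-- The safety invariants. -/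
structure Safe (ids : Fin n → ℕ) (p : PortMapping n) (c : Config (captureElection n)) : Prop where
  id_eq : ∀ u, (c.node u).id = ids u
  asleep : ∀ u, c.awake u = false → c.node u = NodeState.start n (ids u)
  request : ∀ u i q s, c.InTransit u i (.request q) s →
    q = requestKey ids u i ∧ Nat.size i < (c.node u).level
  query : ∀ u i q s, c.InTransit u i (.query q) s →
    ∃ a k, q = requestKey ids a k ∧ Nat.size k < (c.node a).level
  release : ∀ u i q s, c.InTransit u i (.release q) s →
    (c.node u).dead = true ∧ (c.node u).key < q ∧ ∃ a k, q = requestKey ids a k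
  grant : ∀ u i s, c.InTransit u i .grant s → i ∈ (c.node u).granted
  leader : ∀ u i x s, c.InTransit u i (.leader x) s → (c.node u).won = true ∧ x = ids u
  pending : ∀ v j a k, p.toFun (v, j) = (a, k) → (c.node v).pending = some j →
    (c.node v).maxReq = requestKey ids a k ∧ Nat.size k < (c.node a).level
  granted : ∀ v j a k, p.toFun (v, j) = (a, k) → j ∈ (c.node v).granted →
    Nat.size k < (c.node a).level
  granted_dead : ∀ v j, j ∈ (c.node v).granted → (c.node v).dead = true
  owner_granted : ∀ v j, (c.node v).owner = some j → j ∈ (c.node v).granted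
  owner_none : ∀ v, (c.node v).owner = none → (c.node v).granted = ∅
  got_granted : ∀ a k v j, p.toFun (a, k) = (v, j) → k ∈ (c.node a).got → j ∈ (c.node v).granted
  maxReq_le : ∀ v, ∃ a, (c.node v).maxReq ≤ (c.node a).key
  dead_lt : ∀ v, (c.node v).dead = true → ∃ a, (c.node v).key < (c.node a).key
  got_of_level : ∀ a (k : Fin (n - 1)), Nat.size k + 1 < (c.node a).level → k ∈ (c.node a).got
  won_got : ∀ a k, (c.node a).won = true → k ∈ (c.node a).got
  won_output : ∀ a, (c.node a).won = true → (c.node a).output ≠ none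
  output_won : ∀ v x, (c.node v).output = some x → ∃ w, (c.node w).won = true ∧ x = ids w
  won_unique : ∀ a b, (c.node a).won = true → (c.node b).won = true → a = b
  -- All former owners are compared with the current owner only, by the priority with which it
  -- asked.
  lost : ∀ v j o l i a k, p.toFun (v, j) = (o, l) → p.toFun (v, i) = (a, k) →
    (c.node v).owner = some j → i ∈ (c.node v).granted → i ≠ j →
    (c.node a).dead = true ∧ (c.node a).key < requestKey ids o l
  -- The symmetric trace of `lost`, which remains when the owner changes again; the message count
  -- rests on it.
  exclusive : ∀ v i a k j b l, p.toFun (v, i) = (a, k) → p.toFun (v, j) = (b, l) → i ≠ j →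
    i ∈ (c.node v).granted → j ∈ (c.node v).granted →
    ((c.node a).dead = true ∧ (c.node a).level ≤ Nat.size l + 1) ∨
    ((c.node b).dead = true ∧ (c.node b).level ≤ Nat.size k + 1)

theorem Safe.initial (ids : Fin n → ℕ) (p : PortMapping n) :
    Safe ids p (Config.initial (captureElection n) ids) := by
  have h : ∀ u, (Config.initial (captureElection n) ids).node u = NodeState.start n (ids u) :=
    fun u => rfl
  have h' : ∀ u i x s, ¬ (Config.initial (captureElection n) ids).InTransit u i x s :=
    fun u i x s => by simp [Config.InTransit, Config.initial]
  constructor <;> simp only [h, h', false_imp_iff, implies_true] <;>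
    simp [NodeState.start, NodeState.key]
  intro v
  refine ⟨v, ?_⟩
  rw [Prod.Lex.toLex_le_toLex]
  simp

variable {ids : Fin n → ℕ} {p : PortMapping n} {c c' : Config (captureElection n)}

theorem Safe.grows (h : Safe ids p c) (e : Event p c c') (w : Fin n) :
    (c.node w).Grows (c'.node w) :=
  e.grows (fun v hv => by rw [h.asleep v hv]; rfl) w

theorem NodeState.mem_announcements {s : NodeState n} {k : Fin (n - 1)} {x : Msg} :
    (k, x) ∈ s.announcements ↔ x = .leader s.id := by
  simp [NodeState.announcements, eq_comm]

theorem NodeState.mem_requests {s : NodeState n} {k : Fin (n - 1)} {x : Msg} :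
    (k, x) ∈ s.requests ↔ Nat.size k = s.level ∧ x = .request (toLex (s.level + 1, s.id)) := by
  simp only [requests, List.mem_map, List.mem_filter, List.mem_finRange, true_and, Prod.mk.injEq,
    decide_eq_true_eq]
  constructor
  · rintro ⟨a, h1, rfl, rfl⟩; exact ⟨h1, rfl⟩
  · rintro ⟨h1, rfl⟩; exact ⟨k, h1, rfl, rfl⟩

end Safety

end AsyncClique

namespace AsyncClique

section Safety

variable {n : ℕ} {ids : Fin n → ℕ} {p : PortMapping n} {c c' : Config (captureElection n)}

/-- A request carries a priority that its sender has already reached, and priorities never decrease.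
-/
theorem Safe.requestKey_le (h : Safe ids p c) {a : Fin n} {k : Fin (n - 1)}
    (hk : Nat.size k < (c.node a).level) : requestKey ids a k ≤ (c.node a).key := by
  simp only [requestKey, NodeState.key, h.id_eq, Prod.Lex.toLex_le_toLex]
  omega

theorem level_le_of_key_lt {s : NodeState n} {a : Fin n} {k : Fin (n - 1)}
    (hk : s.key < requestKey ids a k) : s.level ≤ Nat.size k + 1 := by
  simp only [requestKey, NodeState.key, Prod.Lex.toLex_lt_toLex] at hk
  omega

/-! ### Preservation of the safety invariants by one event -/

theorem Safe.step_id_eq (h : Safe ids p c) (e : Event p c c') (u : Fin n) :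
    (c'.node u).id = ids u := by
  rw [(h.grows e u).id, h.id_eq]

theorem Safe.step_asleep (h : Safe ids p c) (e : Event p c c') (u : Fin n)
    (hu : c'.awake u = false) : c'.node u = NodeState.start n (ids u) := by
  have := h.asleep u
  rcases e with ⟨v, t, hv, hg, hc, -⟩ | ⟨v, t, hv, hg, hc, -⟩ |
    ⟨u', i, v, j, x, s, t, st, ms, hp, hx, ht, hr, hc⟩ <;>
  have := hc.awake_eq <;> have := hc.awake_ne <;> have := hc.node_ne <;> grind

theorem Safe.step_request (h : Safe ids p c) (e : Event p c c') (u i q s)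
    (hu : c'.InTransit u i (.request q) s) :
    q = requestKey ids u i ∧ Nat.size i < (c'.node u).level := by
  have hi := h.id_eq u
  have ho := h.request u i q s
  have := (h.grows e u).level
  simp only [requestKey] at *
  rcases e with ⟨v, t, hv, hg, hc, -⟩ | ⟨v, t, hv, hg, hc, -⟩ |
    ⟨u', i, v, j, x, s, t, st, ms, hp, hx, ht, hr, hc⟩
  all_goals
    have h3 := hc.transit_or _ _ _ _ hu
    have h1 := hc.node_eq
  on_goal 3 => cases hr
  all_goals grind -ring -linarith -ac [NodeState.mem_requests, NodeState.mem_announcements]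

theorem Safe.step_query (h : Safe ids p c) (e : Event p c c') (u i q s)
    (hu : c'.InTransit u i (.query q) s) :
    ∃ a k, q = requestKey ids a k ∧ Nat.size k < (c'.node a).level := by
  have g := fun a => (h.grows e a).level
  have ho := h.query u i q s
  have hq := h.request
  rcases e with ⟨v, t, hv, hg, hc, -⟩ | ⟨v, t, hv, hg, hc, -⟩ |
    ⟨u', i, v, j, x, s, t, st, ms, hp, hx, ht, hr, hc⟩
  all_goals
    have h3 := hc.transit_or _ _ _ _ hu
  on_goal 3 => cases hr
  all_goals grind -ring -linarith -ac [NodeState.mem_requests, NodeState.mem_announcements]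

theorem Safe.step_release (h : Safe ids p c) (e : Event p c c') (u i q s)
    (hu : c'.InTransit u i (.release q) s) :
    (c'.node u).dead = true ∧ (c'.node u).key < q ∧ ∃ a k, q = requestKey ids a k := by
  have ho := h.release u i q s
  have hq := h.query
  have := (h.grows e u).dead
  have := (h.grows e u).key_eq
  rcases e with ⟨v, t, hv, hg, hc, -⟩ | ⟨v, t, hv, hg, hc, -⟩ |
    ⟨u', i, v, j, x, s, t, st, ms, hp, hx, ht, hr, hc⟩
  all_goals
    have h3 := hc.transit_or _ _ _ _ hu
    have h1 := hc.node_eq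
  on_goal 3 => cases hr
  all_goals grind -ring -linarith -ac [NodeState.mem_requests, NodeState.mem_announcements, NodeState.key]

theorem Safe.step_grant (h : Safe ids p c) (e : Event p c c') (u i s)
    (hu : c'.InTransit u i .grant s) : i ∈ (c'.node u).granted := by
  have ho := h.grant u i s
  have hq := h.owner_granted
  have := (h.grows e u).granted
  rcases e with ⟨v, t, hv, hg, hc, -⟩ | ⟨v, t, hv, hg, hc, -⟩ |
    ⟨u', i, v, j, x, s, t, st, ms, hp, hx, ht, hr, hc⟩
  all_goals
    have h3 := hc.transit_or _ _ _ _ hu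
    have h1 := hc.node_eq
  on_goal 3 => cases hr
  all_goals grind -ring -linarith -ac [NodeState.mem_requests, NodeState.mem_announcements]

theorem Safe.step_leader (h : Safe ids p c) (e : Event p c c') (u i x s)
    (hu : c'.InTransit u i (.leader x) s) : (c'.node u).won = true ∧ x = ids u := by
  have ho := h.leader u i x s
  have hi := h.id_eq u
  have := (h.grows e u).won
  rcases e with ⟨v, t, hv, hg, hc, -⟩ | ⟨v, t, hv, hg, hc, -⟩ |
    ⟨u', i, v, j, x, s, t, st, ms, hp, hx, ht, hr, hc⟩
  all_goals
    have h3 := hc.transit_or _ _ _ _ hu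
    have h1 := hc.node_eq
  on_goal 3 => cases hr
  all_goals grind -ring -linarith -ac [NodeState.mem_requests, NodeState.mem_announcements, NodeState.win]

theorem Safe.step_pending (h : Safe ids p c) (e : Event p c c') (v j a k)
    (hp : p.toFun (v, j) = (a, k)) (hj : (c'.node v).pending = some j) :
    (c'.node v).maxReq = requestKey ids a k ∧ Nat.size k < (c'.node a).level := by
  have g := (h.grows e a).level
  have hq := h.pending v j a k hp
  have hr := h.request
  have hs := p.symm hp
  have ha := h.asleep v
  rcases e with ⟨w, t, hv, hg, hc, -⟩ | ⟨w, t, hv, hg, hc, -⟩ |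
    ⟨u', i, w, j, x, s, t, st, ms, hp, hx, ht, hr, hc⟩
  all_goals
    have h1 := hc.node_eq
    have h2 := hc.node_ne
  on_goal 3 =>
    have := p.symm hp
    cases hr
  all_goals grind -ring -linarith -ac [NodeState.win, NodeState.start]

theorem Safe.step_granted (h : Safe ids p c) (e : Event p c c') (v j a k)
    (hp : p.toFun (v, j) = (a, k)) (hj : j ∈ (c'.node v).granted) :
    Nat.size k < (c'.node a).level := by
  have g := (h.grows e a).level
  have ho := h.granted v j a k hp
  have hq := h.pending v j a k hp
  have hr := h.request
  have hs := p.symm hp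
  rcases e with ⟨w, t, hv, hg, hc, -⟩ | ⟨w, t, hv, hg, hc, -⟩ |
    ⟨u', i, w, j, x, s, t, st, ms, hp, hx, ht, hr, hc⟩
  all_goals
    have h1 := hc.node_eq
    have h2 := hc.node_ne
  on_goal 3 =>
    have := p.symm hp
    cases hr
  all_goals grind -ring -linarith -ac [NodeState.win]

theorem Safe.step_granted_dead (h : Safe ids p c) (e : Event p c c') (v j)
    (hj : j ∈ (c'.node v).granted) : (c'.node v).dead = true := by
  have g := (h.grows e v).dead
  have ho := h.granted_dead v
  have hq := h.owner_granted v
  rcases e with ⟨w, t, hv, hg, hc, -⟩ | ⟨w, t, hv, hg, hc, -⟩ |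
    ⟨u', i, w, j, x, s, t, st, ms, hp, hx, ht, hr, hc⟩
  all_goals
    have h1 := hc.node_eq
    have h2 := hc.node_ne
  on_goal 3 => cases hr
  all_goals grind -ring -linarith -ac [NodeState.win]

theorem Safe.step_owner_granted (h : Safe ids p c) (e : Event p c c') (v j)
    (hj : (c'.node v).owner = some j) : j ∈ (c'.node v).granted := by
  have hq := h.owner_granted v
  rcases e with ⟨w, t, hv, hg, hc, -⟩ | ⟨w, t, hv, hg, hc, -⟩ |
    ⟨u', i, w, j, x, s, t, st, ms, hp, hx, ht, hr, hc⟩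
  all_goals
    have h1 := hc.node_eq
    have h2 := hc.node_ne
  on_goal 3 => cases hr
  all_goals grind -ring -linarith -ac [NodeState.win]

theorem Safe.step_owner_none (h : Safe ids p c) (e : Event p c c') (v)
    (hj : (c'.node v).owner = none) : (c'.node v).granted = ∅ := by
  have hq := h.owner_none v
  rcases e with ⟨w, t, hv, hg, hc, -⟩ | ⟨w, t, hv, hg, hc, -⟩ |
    ⟨u', i, w, j, x, s, t, st, ms, hp, hx, ht, hr, hc⟩
  all_goals
    have h1 := hc.node_eq
    have h2 := hc.node_ne
  on_goal 3 => cases hr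
  all_goals grind -ring -linarith -ac [NodeState.win]

theorem Safe.step_got_granted (h : Safe ids p c) (e : Event p c c') (a k v j)
    (hp : p.toFun (a, k) = (v, j)) (hk : k ∈ (c'.node a).got) : j ∈ (c'.node v).granted := by
  have g := (h.grows e v).granted
  have hq := h.got_granted a k v j hp
  have hg := h.grant v j
  have hs := p.symm hp
  rcases e with ⟨w, t, hv, hg, hc, -⟩ | ⟨w, t, hv, hg, hc, -⟩ |
    ⟨u', i, w, j, x, s, t, st, ms, hp, hx, ht, hr, hc⟩
  all_goals
    have h1 := hc.node_eq
    have h2 := hc.node_ne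
  on_goal 3 =>
    have := p.symm hp
    cases hr
  all_goals grind -ring -linarith -ac [NodeState.win]

theorem Safe.step_maxReq_le (h : Safe ids p c) (e : Event p c c') (v) :
    ∃ a, (c'.node v).maxReq ≤ (c'.node a).key := by
  have g := fun a => (h.grows e a).key
  have hq := h.maxReq_le v
  have hr := h.request
  have hs := @h.requestKey_le
  rcases e with ⟨w, t, hv, hg, hc, -⟩ | ⟨w, t, hv, hg, hc, -⟩ |
    ⟨u', i, w, j, x, s, t, st, ms, hp, hx, ht, hr, hc⟩
  all_goals
    have h1 := hc.node_eq
    have h2 := hc.node_ne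
  on_goal 3 => cases hr
  all_goals grind -ring -linarith -ac [NodeState.win]

/-- What stops a node is a request or query priority already reached by some other candidate.
Consequently a node of largest priority is never stopped. -/
theorem Safe.step_dead_lt (h : Safe ids p c) (e : Event p c c') (v)
    (hv : (c'.node v).dead = true) : ∃ a, (c'.node v).key < (c'.node a).key := by
  have g := fun a => (h.grows e a).key
  have hq := h.dead_lt v
  have g' := (h.grows e v).key_eq
  have hs := @h.requestKey_le
  have hr := h.request
  have hr' := h.query
  have h5 := h.asleep
  rcases e with ⟨w, t, hv, hg, hc, -⟩ | ⟨w, t, hv, hg, hc, -⟩ |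
    ⟨u', i, w, j, x, s, t, st, ms, hp, hx, ht, hr, hc⟩
  all_goals
    have h1 := hc.node_eq
    have h2 := hc.node_ne
  on_goal 3 => cases hr
  all_goals grind -ring -linarith -ac [NodeState.win, NodeState.start, NodeState.key]

theorem Safe.step_got_of_level (h : Safe ids p c) (e : Event p c c') (a) (k : Fin (n - 1))
    (hk : Nat.size k + 1 < (c'.node a).level) : k ∈ (c'.node a).got := by
  have hq := h.got_of_level a k
  have ha := h.asleep a
  rcases e with ⟨w, t, hv, hg, hc, -⟩ | ⟨w, t, hv, hg, hc, -⟩ |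
    ⟨u', i, w, j, x, s, t, st, ms, hp, hx, ht, hr, hc⟩
  all_goals
    have h1 := hc.node_eq
    have h2 := hc.node_ne
  on_goal 3 => cases hr
  all_goals grind -ring -linarith -ac [NodeState.win, NodeState.start]

theorem Safe.step_won_got (h : Safe ids p c) (e : Event p c c') (a) (k)
    (hk : (c'.node a).won = true) : k ∈ (c'.node a).got := by
  have hq := h.won_got a k
  rcases e with ⟨w, t, hv, hg, hc, -⟩ | ⟨w, t, hv, hg, hc, -⟩ |
    ⟨u', i, w, j, x, s, t, st, ms, hp, hx, ht, hr, hc⟩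
  all_goals
    have h1 := hc.node_eq
    have h2 := hc.node_ne
  on_goal 3 => cases hr
  all_goals grind -ring -linarith -ac [NodeState.win, NodeState.start]

theorem Safe.step_won_output (h : Safe ids p c) (e : Event p c c') (a)
    (hk : (c'.node a).won = true) : (c'.node a).output ≠ none := by
  have hq := h.won_output a
  have g := (h.grows e a).output
  rcases e with ⟨w, t, hv, hg, hc, -⟩ | ⟨w, t, hv, hg, hc, -⟩ |
    ⟨u', i, w, j, x, s, t, st, ms, hp, hx, ht, hr, hc⟩
  all_goals
    have h1 := hc.node_eq
    have h2 := hc.node_ne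
  on_goal 3 => cases hr
  all_goals cases ho : (c.node a).output <;> grind [NodeState.win, NodeState.start]

theorem Safe.step_output_won (h : Safe ids p c) (e : Event p c c') (v x)
    (hk : (c'.node v).output = some x) : ∃ w, (c'.node w).won = true ∧ x = ids w := by
  have hq := h.output_won v
  have hi := h.id_eq v
  have hl := h.leader
  have g := fun w => (h.grows e w).won
  rcases e with ⟨w, t, hv, hg, hc, -⟩ | ⟨w, t, hv, hg, hc, -⟩ |
    ⟨u', i, w, j, x, s, t, st, ms, hp, hx, ht, hr, hc⟩
  all_goals
    have h1 := hc.node_eq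
    have h2 := hc.node_ne
  on_goal 3 => cases hr
  all_goals cases ho : (c.node v).output <;> grind [NodeState.win, NodeState.start]

/-- Two winners would have captured, hence stopped, each other; but a node wins only while it is not
stopped. -/
theorem Safe.step_won_unique (h : Safe ids p c) (e : Event p c c') (a b)
    (ha : (c'.node a).won = true) (hb : (c'.node b).won = true) : a = b := by
  have hq := h.won_unique a b
  by_contra hab
  have key : ∀ a b, a ≠ b → (c'.node a).won = true → (c'.node b).dead = true := by
    intro a b hab ha
    obtain ⟨i, j, hij⟩ := p.exists_port (Ne.symm hab)
    exact h.step_granted_dead e b j (h.step_got_granted e a i b j hij (h.step_won_got e a i ha))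
  have h3 := key a b hab ha
  have h4 := key b a (Ne.symm hab) hb
  have h5 := h.asleep
  rcases e with ⟨w, t, hv, hg, hc, -⟩ | ⟨w, t, hv, hg, hc, -⟩ |
    ⟨u', i, w, j, x, s, t, st, ms, hp, hx, ht, hr, hc⟩
  all_goals
    have h1 := hc.node_eq
    have h2 := hc.node_ne
  on_goal 3 => cases hr
  all_goals grind -ring -linarith -ac [NodeState.win, NodeState.start]

/-- A first capture leaves no other granted port. At a recapture the old owner has just certified by
its release that it is stopped below the new priority, and the earlier owners lie below the old
owner. -/
theorem Safe.step_lost (h : Safe ids p c) (e : Event p c c') (v j o l i a k)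
    (hj : p.toFun (v, j) = (o, l)) (hi : p.toFun (v, i) = (a, k))
    (ho : (c'.node v).owner = some j) (hg : i ∈ (c'.node v).granted) (hij : i ≠ j) :
    (c'.node a).dead = true ∧ (c'.node a).key < requestKey ids o l := by
  -- Once stopped, `a` keeps its priority, so the claim may be checked before the event.
  suffices H : (c.node a).dead = true ∧ (c.node a).key < requestKey ids o l by
    rw [(h.grows e a).key_eq H.1]
    exact ⟨(h.grows e a).dead H.1, H.2⟩
  have hq := h.lost v
  rcases e with ⟨w, t, hv, hg, hc, -⟩ | ⟨w, t, hv, hg, hc, -⟩ |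
    ⟨u', i', w, j', x, s, t, st, ms, hp, hx, ht, hr, hc⟩
  all_goals
    have h1 := hc.node_eq
    have h2 := hc.node_ne
  · grind [NodeState.win]
  · grind
  by_cases hvw : v = w
  · subst hvw
    rw [h1] at ho hg
    cases hr with
    | capture q hm hk ho' =>
      rw [h.owner_none v ho'] at hg
      grind
    | recapture q r ho' hm hp' =>
      obtain rfl : r = j := by simpa using ho
      replace hg : i ∈ (c.node v).granted := by simpa [hij] using hg
      have h3 := h.release u' i' q s hx
      have h4 := h.pending v r o l hj hp'
      rw [hm] at h4
      rw [← h4.1]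
      by_cases hi' : i = j'
      · subst hi'
        have := p.symm hp
        grind
      -- The chain is: priority of `a` < request of the old owner `u'` ≤ its current priority <
      -- released priority.
      · have h5 := hq j' u' i' i a k (p.symm hp) hi ho' hg hi'
        have h6 := h.granted v j' u' i' (p.symm hp) (h.owner_granted v _ ho')
        exact ⟨h5.1, (h5.2.trans_le (h.requestKey_le h6)).trans h3.2.1⟩
    | _ => grind [NodeState.win]
  · rw [h2 v hvw] at ho hg
    exact hq j o l i a k hj hi ho hg hij

theorem Event.granted_or (e : Event p c c') (v i)
    (hi : i ∈ (c'.node v).granted) : i ∈ (c.node v).granted ∨ (c'.node v).owner = some i := by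
  rcases e with ⟨w, t, hv, hg, hc, -⟩ | ⟨w, t, hv, hg, hc, -⟩ |
    ⟨u', i, w, j, x, s, t, st, ms, hp, hx, ht, hr, hc⟩
  all_goals
    have h1 := hc.node_eq
    have h2 := hc.node_ne
  on_goal 3 => cases hr
  all_goals grind -ring -linarith -ac [NodeState.win]

/-- A newly granted port belongs to the owner after the event, so a new pair is covered by `lost`;
for old pairs the bound persists because stopped levels are frozen. -/
theorem Safe.step_exclusive (h : Safe ids p c) (e : Event p c c') (v i a k j b l)
    (hi : p.toFun (v, i) = (a, k)) (hj : p.toFun (v, j) = (b, l)) (hij : i ≠ j)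
    (hgi : i ∈ (c'.node v).granted) (hgj : j ∈ (c'.node v).granted) :
    ((c'.node a).dead = true ∧ (c'.node a).level ≤ Nat.size l + 1) ∨
    ((c'.node b).dead = true ∧ (c'.node b).level ≤ Nat.size k + 1) := by
  rcases e.granted_or v i hgi with h1 | h1
  · rcases e.granted_or v j hgj with h2 | h2
    · refine (h.exclusive v i a k j b l hi hj hij h1 h2).imp ?_ ?_ <;> rintro ⟨h3, h4⟩
      · exact ⟨(h.grows e a).dead h3, (h.grows e a).level_eq h3 ▸ h4⟩
      · exact ⟨(h.grows e b).dead h3, (h.grows e b).level_eq h3 ▸ h4⟩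
    · have := h.step_lost e v j b l i a k hj hi h2 hgi hij
      exact .inl ⟨this.1, level_le_of_key_lt this.2⟩
  · have := h.step_lost e v i a k j b l hi hj h1 hgj hij.symm
    exact .inr ⟨this.1, level_le_of_key_lt this.2⟩

theorem Safe.step (h : Safe ids p c) (e : Event p c c') : Safe ids p c' :=
  ⟨h.step_id_eq e, h.step_asleep e, h.step_request e, h.step_query e, h.step_release e,
    h.step_grant e, h.step_leader e, h.step_pending e, h.step_granted e, h.step_granted_dead e,
    h.step_owner_granted e, h.step_owner_none e, h.step_got_granted e, h.step_maxReq_le e,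
    h.step_dead_lt e, h.step_got_of_level e, h.step_won_got e, h.step_won_output e,
    h.step_output_won e, h.step_won_unique e, h.step_lost e, h.step_exclusive e⟩

theorem Reachable.safe {c : Config (captureElection n)} (hc : Reachable ids p c) :
    Safe ids p c :=
  hc.invariant (Safe.initial ids p) fun _ _ _ e h => h.step e

end Safety

end AsyncClique

namespace AsyncClique

/-! ### Liveness -/

section Liveness

variable {n : ℕ} {ids : Fin n → ℕ} {p : PortMapping n} {c c' : Config (captureElection n)}

/-- The request of `a` to the node at its port `k` will still be answered, or it has met a
larger priority. -/
inductive Pursued (ids : Fin n → ℕ) (p : PortMapping n) (c : Config (captureElection n))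
    (a : Fin n) (k : Fin (n - 1)) (v : Fin n) (j : Fin (n - 1)) : Prop
  | request (s) (h : c.InTransit a k (.request (requestKey ids a k)) s)
  | query (s i) (hp : (c.node v).pending = some j) (ho : (c.node v).owner = some i) (hij : i ≠ j)
      (h : c.InTransit v i (.query (requestKey ids a k)) s)
  | release (s i o l) (hp : (c.node v).pending = some j) (ho : (c.node v).owner = some i)
      (hij : i ≠ j) (hl : p.toFun (v, i) = (o, l))
      (h : c.InTransit o l (.release (requestKey ids a k)) s)
  | grant (s) (h : c.InTransit v j .grant s)
  | beaten (b) (h : requestKey ids a k < (c.node b).key)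

/-- The liveness invariants. -/
structure Live (ids : Fin n → ℕ) (p : PortMapping n) (c : Config (captureElection n)) : Prop where
  pursued : ∀ a k v j, p.toFun (a, k) = (v, j) → Nat.size k < (c.node a).level →
    k ∉ (c.node a).got → Pursued ids p c a k v j
  alive : ∀ a, (c.node a).dead = false → (c.node a).won = false → 0 < (c.node a).level →
    ∃ k : Fin (n - 1), Nat.size k < (c.node a).level ∧ k ∉ (c.node a).got
  started : ∀ u, c.awake u = true → ∃ a, 0 < (c.node a).level ∨ (c.node a).won = true
  announced : ∀ a k v j, p.toFun (a, k) = (v, j) → (c.node a).won = true →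
    (∃ s, c.InTransit a k (.leader (ids a)) s) ∨ (c.node v).output ≠ none

theorem Live.initial (ids : Fin n → ℕ) (p : PortMapping n) :
    Live ids p (Config.initial (captureElection n) ids) := by
  have h : ∀ u, (Config.initial (captureElection n) ids).node u = NodeState.start n (ids u) :=
    fun u => rfl
  constructor <;> simp only [h] <;> simp [NodeState.start, Config.initial]

/-! ### The fate of an open request under one event -/

theorem Safe.requestKey_lt (h : Safe ids p c) (hinj : Function.Injective ids) {a b : Fin n}
    {k : Fin (n - 1)} (hab : b ≠ a) (hk : requestKey ids a k ≤ (c.node b).key) :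
    requestKey ids a k < (c.node b).key := by
  refine lt_of_le_of_ne hk fun h' => hab ?_
  simp only [requestKey, NodeState.key, h.id_eq] at h'
  exact (hinj (Prod.mk.inj (toLex.injective h')).2).symm

theorem Safe.pursued_of_request (h : Safe ids p c) (hinj : Function.Injective ids)
    (e : Event p c c') {a k v j} (hp : p.toFun (a, k) = (v, j)) {s}
    (hs : c.InTransit a k (.request (requestKey ids a k)) s) : Pursued ids p c' a k v j := by
  have g := fun b => (h.grows e b).key
  rcases e with ⟨w, t, hv, hg, hc, -⟩ | ⟨w, t, hv, hg, hc, -⟩ |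
    ⟨u', i, w, j', x, s', t, st, ms, hp', hx, ht, hr, hc⟩
  · exact .request s ((hc.transit_old _ _ _ _ hs).resolve_right id)
  · exact .request s ((hc.transit_old _ _ _ _ hs).resolve_right id)
  rcases hc.transit_old _ _ _ _ hs with h1 | ⟨rfl, rfl, rfl, rfl⟩
  · exact .request s h1
  rw [hp] at hp'
  obtain ⟨rfl, rfl⟩ := Prod.mk.inj hp'
  have h1 := hc.node_eq
  cases hr with
  | outbid _ h2 =>
    obtain ⟨b, hb⟩ := h.maxReq_le v
    exact .beaten b (h2.trans_le (hb.trans (g b)))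
  | selfOutbid _ h2 ho =>
    exact .beaten v ((h.requestKey_lt hinj (p.ne hp) h2).trans_le (g v))
  | capture => exact .grant t (hc.transit_new _ _ (by simp))
  | again => exact .grant t (hc.transit_new _ _ (by simp))
  | ask _ i _ ho hij =>
    exact .query t i (by rw [h1]) (by rw [h1, ho]) hij (hc.transit_new _ _ (by simp))

theorem Safe.pursued_of_grant (e : Event p c c') {a k v j}
    (hp : p.toFun (a, k) = (v, j)) (hg : k ∉ (c'.node a).got) {s}
    (hs : c.InTransit v j .grant s) : Pursued ids p c' a k v j := by
  rcases e with ⟨w, t, hv, hg, hc, -⟩ | ⟨w, t, hv, hg, hc, -⟩ |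
    ⟨u', i, w, j', x, s', t, st, ms, hp', hx, ht, hr, hc⟩
  · exact .grant s ((hc.transit_old _ _ _ _ hs).resolve_right id)
  · exact .grant s ((hc.transit_old _ _ _ _ hs).resolve_right id)
  rcases hc.transit_old _ _ _ _ hs with h1 | ⟨rfl, rfl, rfl, rfl⟩
  · exact .grant s h1
  rw [p.symm hp] at hp'
  obtain ⟨rfl, rfl⟩ := Prod.mk.inj hp'
  have h1 := hc.node_eq
  rw [h1] at hg
  cases hr <;> simp [NodeState.win] at hg

/-- As long as the owner of `v` is asked on behalf of the node at port `j`, nothing else happens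
at `v`, except that a larger request supersedes. -/
theorem Safe.pending_step (h : Safe ids p c) (hinj : Function.Injective ids)
    (e : Event p c c') {a k v j i} (hp : p.toFun (a, k) = (v, j))
    (hpe : (c.node v).pending = some j) (ho : (c.node v).owner = some i) :
    ((c'.node v).pending = some j ∧ (c'.node v).owner = some i) ∨ Pursued ids p c' a k v j := by
  have hm := h.pending v j a k (p.symm hp) hpe
  rcases e with ⟨w, t, hv, hg, hc, -⟩ | ⟨w, t, hv, hg, hc, -⟩ |
    ⟨u', i', w, j', x, s', t, st, ms, hp', hx, ht, hr, hc⟩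
  all_goals
    have h1 := hc.node_eq
    have h2 := hc.node_ne
    by_cases hvw : v = w
    swap
    · rw [h2 v hvw]
      exact .inl ⟨hpe, ho⟩
    subst hvw
    rw [h1]
  · exact .inl ⟨hpe, ho⟩
  · exact .inl ⟨hpe, ho⟩
  have e' : Event p c c' := .receive u' i' v j' x s' t st ms hp' hx ht hr hc
  cases hr with
  | capture _ _ _ ho' => simp [ho] at ho'
  | ask q i1 hq ho' hij =>
    by_cases hjj : j' = j
    · exact .inl ⟨by simp [hjj], ho⟩
    · right
      obtain ⟨rfl, hl⟩ := h.request u' i' q s' hx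
      have hne := p.node_ne (p.symm hp') (p.symm hp) hjj
      rw [hm.1] at hq
      -- The superseding request is at least as large and comes from another node; distinct IDs make
      -- it strictly larger.
      exact .beaten u' ((h.requestKey_lt hinj hne (hq.trans (h.requestKey_le hl))).trans_le
        (h.grows e' u').key)
  | recapture q i1 ho' hq hp1 =>
    rw [hpe] at hp1
    obtain rfl := Option.some.inj hp1
    exact .inr (.grant t (hc.transit_new _ _ (by simp)))
  | _ => exact .inl ⟨hpe, ho⟩

theorem Safe.pursued_of_query (h : Safe ids p c) (hinj : Function.Injective ids)
    (e : Event p c c') {a k v j i} (hp : p.toFun (a, k) = (v, j))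
    (hpe : (c.node v).pending = some j) (ho : (c.node v).owner = some i) (hij : i ≠ j) {s}
    (hs : c.InTransit v i (.query (requestKey ids a k)) s) : Pursued ids p c' a k v j := by
  rcases h.pending_step hinj e hp hpe ho with ⟨h1, h2⟩ | h1
  swap
  · exact h1
  have g := fun b => (h.grows e b).key
  rcases e with ⟨w, t, hv, hg, hc, -⟩ | ⟨w, t, hv, hg, hc, -⟩ |
    ⟨u', i', w, j', x, s', t, st, ms, hp', hx, ht, hr, hc⟩
  · exact .query s i h1 h2 hij ((hc.transit_old _ _ _ _ hs).resolve_right id)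
  · exact .query s i h1 h2 hij ((hc.transit_old _ _ _ _ hs).resolve_right id)
  rcases hc.transit_old _ _ _ _ hs with h3 | ⟨rfl, rfl, rfl, rfl⟩
  · exact .query s i h1 h2 hij h3
  cases hr with
  | stay _ hq =>
    exact .beaten w ((h.requestKey_lt hinj (p.node_ne hp' (p.symm hp) hij) hq).trans_le (g w))
  | release _ hq => exact .release t i w j' h1 h2 hij hp' (hc.transit_new _ _ (by simp))

theorem Safe.pursued_of_release (h : Safe ids p c) (hinj : Function.Injective ids)
    (e : Event p c c') {a k v j i o l} (hp : p.toFun (a, k) = (v, j))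
    (hpe : (c.node v).pending = some j) (ho : (c.node v).owner = some i) (hij : i ≠ j)
    (hl : p.toFun (v, i) = (o, l)) {s}
    (hs : c.InTransit o l (.release (requestKey ids a k)) s) : Pursued ids p c' a k v j := by
  rcases h.pending_step hinj e hp hpe ho with ⟨h1, h2⟩ | h1
  swap
  · exact h1
  rcases e with ⟨w, t, hv, hg, hc, -⟩ | ⟨w, t, hv, hg, hc, -⟩ |
    ⟨u', i', w, j', x, s', t, st, ms, hp', hx, ht, hr, hc⟩
  · exact .release s i o l h1 h2 hij hl ((hc.transit_old _ _ _ _ hs).resolve_right id)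
  · exact .release s i o l h1 h2 hij hl ((hc.transit_old _ _ _ _ hs).resolve_right id)
  rcases hc.transit_old _ _ _ _ hs with h3 | ⟨rfl, rfl, rfl, rfl⟩
  · exact .release s i o l h1 h2 hij hl h3
  rw [p.symm hl] at hp'
  obtain ⟨rfl, rfl⟩ := Prod.mk.inj hp'
  cases hr with
  | stale _ hq =>
    -- The release cannot be stale: the owner is unchanged, and while `j` is pending `maxReq` is
    -- still the priority of the request of `a`.
    have := hq ho (h.pending v j a k (p.symm hp) hpe).1
    simp [hpe] at this
  | recapture _ i1 _ _ hp1 =>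
    rw [hpe] at hp1
    obtain rfl := Option.some.inj hp1
    exact .grant t (hc.transit_new _ _ (by simp))

theorem Event.request_or (e : Event p c c') (hi : ∀ u, (c.node u).id = ids u) {a : Fin n}
    {k : Fin (n - 1)} (hk : Nat.size k < (c'.node a).level) :
    Nat.size k < (c.node a).level ∨ ∃ s, c'.InTransit a k (.request (requestKey ids a k)) s := by
  have := hi a
  rcases e with ⟨w, t, hv, hg, hc, -⟩ | ⟨w, t, hv, hg, hc, -⟩ |
    ⟨u', i, w, j, x, s, t, st, ms, hp, hx, ht, hr, hc⟩
  all_goals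
    have h1 := hc.node_eq
    have h2 := hc.node_ne
    have h3 := hc.transit_new k (.request (requestKey ids a k))
  on_goal 3 => cases hr
  all_goals grind -ring -linarith -ac [NodeState.win, NodeState.mem_requests, requestKey]

theorem Live.step_pursued (h : Live ids p c) (hs : Safe ids p c) (hinj : Function.Injective ids)
    (e : Event p c c') (a k v j) (hp : p.toFun (a, k) = (v, j))
    (hk : Nat.size k < (c'.node a).level) (hg : k ∉ (c'.node a).got) :
    Pursued ids p c' a k v j := by
  rcases e.request_or hs.id_eq hk with hl | ⟨s, hr⟩
  swap
  · exact .request s hr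
  cases h.pursued a k v j hp hl fun h' => hg ((hs.grows e a).got h') with
  | request s hr => exact hs.pursued_of_request hinj e hp hr
  | query s i hpe ho hij hr => exact hs.pursued_of_query hinj e hp hpe ho hij hr
  | release s i o l hpe ho hij hl hr => exact hs.pursued_of_release hinj e hp hpe ho hij hl hr
  | grant s hr => exact Safe.pursued_of_grant e hp hg hr
  | beaten b hb => exact .beaten b (hb.trans_le (hs.grows e b).key)

/-- If some port is not among those with `Nat.size k < l`, then some port has `Nat.size k = l`. -/
theorem exists_size_eq {m l : ℕ} {i : Fin m} (h : l ≤ Nat.size i) :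
    ∃ k : Fin m, Nat.size k = l := by
  rcases Nat.eq_zero_or_pos l with rfl | hl
  · exact ⟨⟨0, i.pos⟩, by simp⟩
  -- This is the least number of size `l`, hence at most `i`.
  · refine ⟨⟨2 ^ (l - 1), lt_of_le_of_lt ?_ i.isLt⟩, ?_⟩
    · rw [← Nat.lt_size]; omega
    · simp only [Nat.size_pow]; omega

/-- A candidate that moves up has a port left, so by `exists_size_eq` its new block is nonempty.
That block is disjoint from the captured ports, which all have smaller size. -/
theorem Live.step_alive (h : Live ids p c) (hs : Safe ids p c) (e : Event p c c') (a)
    (hd : (c'.node a).dead = false) (hw : (c'.node a).won = false)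
    (hl : 0 < (c'.node a).level) :
    ∃ k : Fin (n - 1), Nat.size k < (c'.node a).level ∧ k ∉ (c'.node a).got := by
  have h4 := h.alive a
  have h5 := hs.asleep a
  have h6 : ∀ k, k ∈ (c.node a).got → Nat.size k < (c.node a).level := by
    intro k hk
    exact hs.granted _ _ a k (p.symm (Prod.mk.eta).symm) (hs.got_granted a k _ _ Prod.mk.eta.symm hk)
  have h7 := fun k => hs.granted a k
  have h8 := @exists_size_eq (n - 1) (c.node a).level
  have h9 := hs.grant
  rcases e with ⟨w, t, hv, hg, hc, -⟩ | ⟨w, t, hv, hg, hc, -⟩ |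
    ⟨u', i, w, j, x, s, t, st, ms, hp, hx, ht, hr, hc⟩
  all_goals
    have h1 := hc.node_eq
    have h2 := hc.node_ne
  on_goal 3 =>
    have := p.symm hp
    cases hr
  case receive.levelUp hd hw hl' h' =>
    by_cases haw : a = w
    · subst haw
      obtain ⟨k0, hk0⟩ := h'
      obtain ⟨k, hk⟩ := h8 (i := k0) (by by_contra hh; exact hk0 (hl' k0 (by omega)))
      have := hs.granted u' i a j hp (h9 u' i s hx)
      refine ⟨k, by rw [h1]; simp only; omega, ?_⟩
      rw [h1]
      simp only [Finset.mem_insert, not_or]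
      refine ⟨?_, fun hh => ?_⟩
      · rintro rfl; omega
      · have := h6 k hh; omega
    · rw [h2 a haw] at *
      exact h4 ‹_› ‹_› ‹_›
  all_goals clear h7 h9
  all_goals grind -ring -linarith -ac [NodeState.win, NodeState.start]

theorem Live.step_started (h : Live ids p c) (hs : Safe ids p c) (e : Event p c c') (u)
    (_ : c'.awake u = true) : ∃ a, 0 < (c'.node a).level ∨ (c'.node a).won = true := by
  have h4 := h.started
  have h5 := hs.asleep
  have g := fun w => (hs.grows e w).level
  have g' := fun w => (hs.grows e w).won
  rcases e with ⟨w, t, hv, hg, hc, -⟩ | ⟨w, t, hv, hg, hc, -⟩ |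
    ⟨u', i, w, j, x, s, t, st, ms, hp, hx, ht, hr, hc⟩
  · exact ⟨w, .inr (by rw [hc.node_eq]; rfl)⟩
  · exact ⟨w, .inl (by rw [hc.node_eq]; simp)⟩
  · have : ∃ a, 0 < (c.node a).level ∨ (c.node a).won = true := by
      -- A sleeping sender admits only a query in transit, and a query names a candidate of positive
      -- level.
      cases ha : c.awake u'
      · have h6 := h5 u' ha
        cases x with
        | request q => have := hs.request _ _ _ _ hx; simp [h6, NodeState.start] at this
        | query q =>
          obtain ⟨b, k, -, hk⟩ := hs.query _ _ _ _ hx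
          exact ⟨b, .inl (by omega)⟩
        | release q => have := hs.release _ _ _ _ hx; simp [h6, NodeState.start] at this
        | grant => have := hs.grant _ _ _ hx; simp [h6, NodeState.start] at this
        | leader q => have := hs.leader _ _ _ _ hx; simp [h6, NodeState.start] at this
      · exact h4 u' ha
    obtain ⟨a, ha⟩ := this
    exact ⟨a, ha.imp (fun h => h.trans_le (g a)) (g' a)⟩

theorem Live.step_announced (h : Live ids p c) (hs : Safe ids p c) (e : Event p c c') (a k v j)
    (hp : p.toFun (a, k) = (v, j)) (ha : (c'.node a).won = true) :
    (∃ s, c'.InTransit a k (.leader (ids a)) s) ∨ (c'.node v).output ≠ none := by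
  have h4 := h.announced a k v j hp
  have h5 := hs.id_eq a
  have g : (c.node v).output ≠ none → (c'.node v).output ≠ none := by
    have := (hs.grows e v).output
    cases h : (c.node v).output <;> grind
  rcases e with ⟨w, t, hv, hg, hc, -⟩ | ⟨w, t, hv, hg, hc, -⟩ |
    ⟨u', i, w, j, x, s, t, st, ms, hp, hx, ht, hr, hc⟩
  all_goals
    have h1 := hc.node_eq
    have h2 := hc.node_ne
    have h3 := hc.transit_new k (.leader (ids a))
    have h6 := hc.transit_old a k (.leader (ids a))
  on_goal 3 => cases hr
  case receive.hear =>
    have : (c'.node w).output ≠ none := by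
      rw [h1]; cases (c.node w).output <;> simp
    grind
  all_goals grind -ring -linarith -ac [NodeState.win, NodeState.mem_announcements]

theorem Live.step (h : Live ids p c) (hs : Safe ids p c) (hinj : Function.Injective ids)
    (e : Event p c c') : Live ids p c' :=
  ⟨h.step_pursued hs hinj e, h.step_alive hs e, h.step_started hs e, h.step_announced hs e⟩

theorem Reachable.live (hinj : Function.Injective ids) {c : Config (captureElection n)}
    (hc : Reachable ids p c) : Live ids p c :=
  hc.invariant (Live.initial ids p) fun _ _ hb e h => h.step hb.safe hinj e

/-- When no message is in transit any more, a leader is elected and known to all nodes. -/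
theorem Reachable.elected (hinj : Function.Injective ids) {c : Config (captureElection n)}
    (hc : Reachable ids p c) (hq : c.Quiescent) :
    ∃ w : Fin n, ∀ u, (c.node u).output = some (ids w) := by
  have hs := hc.safe
  have hl := hc.live hinj
  have ht : ∀ u i x s, ¬ c.InTransit u i x s := fun u i x s h => by
    simp [Config.InTransit, hq.2] at h
  suffices ∃ w, (c.node w).won = true by
    obtain ⟨w, hw⟩ := this
    refine ⟨w, fun u => ?_⟩
    have : (c.node u).output ≠ none := by
      by_cases huw : u = w
      · subst huw; exact hs.won_output u hw
      · obtain ⟨i, j, hij⟩ := p.exists_port huw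
        exact (hl.announced w i u j hij hw).resolve_left fun ⟨s, h⟩ => ht _ _ _ _ h
    obtain ⟨x, hx⟩ := Option.ne_none_iff_exists'.1 this
    obtain ⟨w', hw', rfl⟩ := hs.output_won u x hx
    rw [hx, hs.won_unique w w' hw hw']
  by_contra! hw
  obtain ⟨u, hu⟩ := hq.1
  -- The node `m` of largest priority is a candidate, is not stopped, and has an open request.
  obtain ⟨m, -, hm⟩ := Finset.exists_max_image Finset.univ (fun a => (c.node a).key)
    ⟨u, Finset.mem_univ u⟩
  obtain ⟨a, ha⟩ := hl.started u hu
  have ha' : 0 < (c.node m).level := by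
    have h1 := hm a (Finset.mem_univ a)
    have h2 := ha.resolve_right (hw a)
    simp only [NodeState.key, Prod.Lex.toLex_le_toLex] at h1
    omega
  have hd : (c.node m).dead = false := by
    by_contra hd
    obtain ⟨b, hb⟩ := hs.dead_lt m (by simpa using hd)
    exact absurd hb (not_lt.2 (hm b (Finset.mem_univ b)))
  obtain ⟨k, hk, hg⟩ := hl.alive m hd (by simpa using hw m) ha'
  cases hl.pursued m k _ _ Prod.mk.eta.symm hk hg with
  | request s h => exact ht _ _ _ _ h
  | query s i _ _ _ h => exact ht _ _ _ _ h
  | release s i o l _ _ _ _ h => exact ht _ _ _ _ h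
  | grant s h => exact ht _ _ _ _ h
  | beaten b hb =>
    have h1 := hb.trans_le (hm b (Finset.mem_univ b))
    -- Only the last block can be open, so the request carries the current, maximal priority of `m`
    -- and cannot be beaten.
    have h2 : ¬ Nat.size k + 1 < (c.node m).level := fun h => hg (hs.got_of_level m k h)
    have h3 : (c.node m).level = Nat.size k + 1 := by omega
    simp only [requestKey, NodeState.key, hs.id_eq, h3, lt_irrefl] at h1

end Liveness

end AsyncClique

namespace AsyncClique

/-! ### Running time -/

section Time

variable {n : ℕ} {ids : Fin n → ℕ} {p : PortMapping n} {c c' : Config (captureElection n)}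

/-- The latest time, counted from the last spontaneous wake-up, at which a message is sent by
`u` over port `i`. -/
noncomputable def sendTime (p : PortMapping n) (u : Fin n) (i : Fin (n - 1)) : Msg → ℝ
  -- With `l` the size of the requested port, request, query, release and grant are due at `4 * l`,
  -- `4 * l + 1`, `4 * l + 2`, `4 * l + 3`; the priority carries level `l + 1`, hence the offsets
  -- `-3` and `-2`.
  | .request _ => 4 * (Nat.size i : ℝ)
  | .query q => 4 * ((ofLex q).1 : ℝ) - 3
  | .release q => 4 * ((ofLex q).1 : ℝ) - 2
  | .grant => 4 * (Nat.size (p.toFun (u, i)).2 : ℝ) + 3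
  | .leader _ => 4 * (Nat.size n : ℝ) + 4

/-- The invariants on times. -/
structure Timely (p : PortMapping n) (c : Config (captureElection n)) : Prop where
  sent : ∀ u i x s, c.InTransit u i x s → s ≤ c.lastWake + sendTime p u i x
  now : c.now ≤ c.lastWake + (4 * Nat.size n + 5)

theorem Safe.sendTime_le (h : Safe ids p c) {u i x s} (hx : c.InTransit u i x s) :
    sendTime p u i x ≤ 4 * Nat.size n + 4 := by
  have hle : ∀ k : Fin (n - 1), (Nat.size k : ℝ) ≤ Nat.size n := fun k => by
    have : Nat.size k ≤ Nat.size n := Nat.size_le_size (by omega)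
    exact_mod_cast this
  cases x with
  | request q => simp only [sendTime]; linarith [hle i]
  | query q =>
    obtain ⟨a, k, rfl, -⟩ := h.query _ _ _ _ hx
    simp only [sendTime, requestKey, ofLex_toLex]
    push_cast
    linarith [hle k]
  | release q =>
    obtain ⟨-, -, a, k, rfl⟩ := h.release _ _ _ _ hx
    simp only [sendTime, requestKey, ofLex_toLex]
    push_cast
    linarith [hle k]
  | grant => simp only [sendTime]; linarith [hle (p.toFun (u, i)).2]
  | leader => exact le_rfl

/-- A message sent as a reaction is sent at most one unit of time after the message that caused
it. -/
theorem Safe.sendTime_reaction (h : Safe ids p c) {u i v j x s}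
    (hp : p.toFun (u, i) = (v, j)) (hx : c.InTransit u i x s) {st ms}
    (hr : NodeState.Reacts (c.node v) j x st ms) {k y} (hy : (k, y) ∈ ms) :
    sendTime p u i x + 1 ≤ sendTime p v k y := by
  have hle : ∀ k : Fin (n - 1), (Nat.size k : ℝ) ≤ Nat.size n := fun k => by
    have : Nat.size k ≤ Nat.size n := Nat.size_le_size (by omega)
    exact_mod_cast this
  cases hr with
  | outbid => simp at hy
  | selfOutbid => simp at hy
  | capture q =>
    simp only [List.mem_singleton, Prod.mk.injEq] at hy
    obtain ⟨rfl, rfl⟩ := hy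
    simp only [sendTime, p.symm hp]
    linarith
  | again q =>
    simp only [List.mem_singleton, Prod.mk.injEq] at hy
    obtain ⟨rfl, rfl⟩ := hy
    simp only [sendTime, p.symm hp]
    linarith
  | ask q =>
    simp only [List.mem_singleton, Prod.mk.injEq] at hy
    obtain ⟨rfl, rfl⟩ := hy
    obtain ⟨rfl, -⟩ := h.request _ _ _ _ hx
    simp only [sendTime, requestKey, ofLex_toLex]
    push_cast
    linarith
  | stay => simp at hy
  | release q =>
    simp only [List.mem_singleton, Prod.mk.injEq] at hy
    obtain ⟨rfl, rfl⟩ := hy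
    simp only [sendTime]
    linarith
  | stale => simp at hy
  | recapture q r ho hm hpe =>
    simp only [List.mem_singleton, Prod.mk.injEq] at hy
    obtain ⟨rfl, rfl⟩ := hy
    rw [(h.pending v k _ _ rfl hpe).1] at hm
    subst hm
    simp only [sendTime, requestKey, ofLex_toLex]
    push_cast
    linarith
  | wait => simp at hy
  | win =>
    rw [NodeState.mem_announcements] at hy
    subst hy
    simp only [sendTime, hp]
    linarith [hle j]
  | levelUp =>
    rw [NodeState.mem_requests] at hy
    obtain ⟨h1, rfl⟩ := hy
    have h2 := h.granted u i v j hp (h.grant _ _ _ hx)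
    simp only [sendTime, hp]
    -- The captured port lies below the old level, which is the size of the newly requested ports.
    have : (Nat.size j : ℝ) + 1 ≤ Nat.size k := by exact_mod_cast (by omega)
    linarith
  | hear => simp at hy

/-- Wake-ups only move `lastWake` forward and so relax the old deadlines; a delivery costs at most
one unit, which `sendTime_reaction` allows for. -/
theorem Timely.step (h : Timely p c) (hs : Safe ids p c) (e : Event p c c') : Timely p c' := by
  rcases e with ⟨w, t, hv, hg, hc, hw⟩ | ⟨w, t, hv, hg, hc, hw⟩ |
    ⟨u', i', w, j, x, s', t, st, ms, hp, hx, ht, hr, hc⟩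
  · constructor
    · intro u i y s hy
      rcases hc.transit_or _ _ _ _ hy with h1 | ⟨rfl, rfl, h1⟩
      · exact (h.sent u i y s h1).trans (by linarith [hc.wake_le])
      · rw [NodeState.mem_announcements] at h1
        subst h1
        simp only [sendTime, hw]
        have : (0 : ℝ) ≤ Nat.size n := Nat.cast_nonneg _
        linarith
    · rw [hc.now_eq, hw]
      have : (0 : ℝ) ≤ Nat.size n := Nat.cast_nonneg _
      linarith
  · constructor
    · intro u i y s hy
      rcases hc.transit_or _ _ _ _ hy with h1 | ⟨rfl, rfl, h1⟩
      · exact (h.sent u i y s h1).trans (by linarith [hc.wake_le])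
      · rw [NodeState.mem_requests] at h1
        obtain ⟨-, rfl⟩ := h1
        simp only [sendTime, hw]
        have : (0 : ℝ) ≤ Nat.size i := Nat.cast_nonneg _
        linarith
    · rw [hc.now_eq, hw]
      have : (0 : ℝ) ≤ Nat.size n := Nat.cast_nonneg _
      linarith
  · have h2 := h.sent _ _ _ _ hx
    have hw := hc.wake_le
    constructor
    · intro u i y s hy
      rcases hc.transit_or _ _ _ _ hy with h1 | ⟨rfl, rfl, h1⟩
      · exact (h.sent u i y s h1).trans (by linarith)
      · linarith [hs.sendTime_reaction hp hx hr h1]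
    · rw [hc.now_eq]
      linarith [hs.sendTime_le hx]

theorem Reachable.timely {c : Config (captureElection n)} (hc : Reachable ids p c) :
    Timely p c := by
  refine hc.invariant ⟨fun u i x s h => ?_, ?_⟩ fun _ _ hb e h => h.step hb.safe e
  · simp [Config.InTransit, Config.initial] at h
  · have : (0 : ℝ) ≤ Nat.size n := Nat.cast_nonneg _
    simp only [Config.initial]
    linarith

/-- In a network of one node no time passes after the last wake-up. -/
theorem Reachable.now_eq_of_one {ids : Fin 1 → ℕ} {p : PortMapping 1}
    {c : Config (captureElection 1)} (hc : Reachable ids p c) : c.now = c.lastWake := by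
  refine hc.invariant (I := fun c => c.now = c.lastWake) rfl fun c c' _ e _ => ?_
  rcases e with ⟨w, t, hv, hg, hc, hw⟩ | ⟨w, t, hv, hg, hc, hw⟩ |
    ⟨u', i', w, j, x, s', t, st, ms, hp, hx, ht, hr, hc⟩
  · rw [hc.now_eq, hw]
  · rw [hc.now_eq, hw]
  · exact j.elim0

theorem size_le_log {m : ℕ} (hm : 1 ≤ m) :
    (Nat.size m : ℝ) ≤ Real.log m / Real.log 2 + 1 := by
  have h2 : 0 < Real.log 2 := Real.log_pos one_lt_two
  obtain ⟨l, hl⟩ : ∃ l, Nat.size m = l + 1 := ⟨Nat.size m - 1, by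
    have := Nat.size_pos.2 hm; omega⟩
  have h : 2 ^ l ≤ m := Nat.lt_size.1 (by omega)
  rw [hl]
  push_cast
  gcongr
  rw [le_div_iff₀ h2, ← Real.log_pow]
  exact Real.log_le_log (by positivity) (by exact_mod_cast h)

theorem timeAtMost (hn : 1 ≤ n) : TimeAtMost (captureElection n) ids p (13 / Real.log 2 * Real.log n) := by
  intro c hc
  -- For one node `log n = 0`, so the additive constants could not be absorbed. Otherwise `4 * (L +
  -- 1) + 5 ≤ 13 * L` with `L = log₂ n ≥ 1`.
  rcases hn.eq_or_lt with rfl | hn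
  · simpa using hc.now_eq_of_one.le
  · refine hc.timely.now.trans ?_
    have h2 : 0 < Real.log 2 := Real.log_pos one_lt_two
    have h3 : 1 ≤ Real.log n / Real.log 2 := by
      rw [le_div_iff₀ h2, one_mul]
      exact Real.log_le_log two_pos (by exact_mod_cast hn)
    have h4 := size_le_log hn.le
    have h5 : 13 / Real.log 2 * Real.log n = 13 * (Real.log n / Real.log 2) := by ring
    rw [h5]
    linarith

/-! ### Message size -/

/-- Each pairing at most squares (maximum + 1). Two nested pairings thus stay polynomial in `N`; the
exponents are generous. -/
theorem Msg.encode_lt {l i N : ℕ} (hN : 2 ≤ N) (hl : l ≤ N) (hi : i < N) :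
    (Msg.request (toLex (l, i))).encode < N ^ 16 ∧ (Msg.query (toLex (l, i))).encode < N ^ 16 ∧
    (Msg.release (toLex (l, i))).encode < N ^ 16 ∧ Msg.grant.encode < N ^ 16 ∧
    (Msg.leader i).encode < N ^ 16 := by
  have h1 : ∀ t x, t ≤ 4 → x ≤ N ^ 5 → Nat.pair t x < N ^ 16 := by
    intro t x ht hx
    refine (Nat.pair_lt_max_add_one_sq t x).trans_le ?_
    have h5 : 2 ^ 5 ≤ N ^ 5 := Nat.pow_le_pow_left hN 5
    have h6 : max t x + 1 ≤ N ^ 8 := by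
      have : max t x ≤ N ^ 5 := max_le (by omega) hx
      calc max t x + 1 ≤ N ^ 5 * 2 := by omega
        _ ≤ N ^ 5 * N := Nat.mul_le_mul_left _ hN
        _ = N ^ 6 := by ring
        _ ≤ N ^ 8 := Nat.pow_le_pow_right (by omega) (by omega)
    calc (max t x + 1) ^ 2 ≤ (N ^ 8) ^ 2 := Nat.pow_le_pow_left h6 2
      _ = N ^ 16 := by ring
  have h2 : Nat.pair l i ≤ N ^ 5 := by
    refine (Nat.pair_lt_max_add_one_sq l i).le.trans ?_
    have h6 : max l i + 1 ≤ N ^ 2 := by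
      have : max l i ≤ N := max_le hl hi.le
      nlinarith
    calc (max l i + 1) ^ 2 ≤ (N ^ 2) ^ 2 := Nat.pow_le_pow_left h6 2
      _ = N ^ 4 := by ring
      _ ≤ N ^ 5 := Nat.pow_le_pow_right (by omega) (by omega)
  have h3 : i ≤ N ^ 5 := hi.le.trans (Nat.le_self_pow (by omega) N)
  exact ⟨h1 _ _ (by omega) h2, h1 _ _ (by omega) h2, h1 _ _ (by omega) h2,
    h1 _ _ (by omega) (by omega), h1 _ _ (by omega) h3⟩

theorem messageBitsAtMost (hinj : Function.Injective ids) {N : ℕ} (hN : ∀ u, ids u < N) :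
    MessageBitsAtMost (captureElection n) ids p (17 / Real.log 2 * Real.log N) := by
  intro c hc u i y hy
  obtain ⟨x, hx⟩ := hc.encoded u i y hy
  have hs := hc.safe
  have hx' : c.InTransit u i x y.2 := by simpa [Config.InTransit, hx] using hy
  have hn : 2 ≤ n := by have := i.isLt; omega
  -- Distinct IDs below `N` force `n ≤ N`, so levels are bounded by `N` as well.
  have hnN : n ≤ N := by
    have := Fintype.card_le_of_injective (fun u => (⟨ids u, hN u⟩ : Fin N))
      fun a b h => hinj (by simpa using h)
    simpa using this
  have hlt : x.encode < N ^ 16 := by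
    have hN2 : 2 ≤ N := hn.trans hnN
    have hsize : ∀ k : Fin (n - 1), Nat.size k + 1 ≤ N := fun k => by
      have : Nat.size k ≤ k := Nat.size_le.2 Nat.lt_two_pow_self
      omega
    cases x with
    | request q =>
      obtain ⟨rfl, -⟩ := hs.request _ _ _ _ hx'
      exact (Msg.encode_lt hN2 (hsize i) (hN u)).1
    | query q =>
      obtain ⟨a, k, rfl, -⟩ := hs.query _ _ _ _ hx'
      exact (Msg.encode_lt hN2 (hsize k) (hN a)).2.1
    | release q =>
      obtain ⟨-, -, a, k, rfl⟩ := hs.release _ _ _ _ hx'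
      exact (Msg.encode_lt hN2 (hsize k) (hN a)).2.2.1
    | grant => exact (Msg.encode_lt hN2 (hsize i) (hN u)).2.2.2.1
    | leader l =>
      obtain ⟨-, rfl⟩ := hs.leader _ _ _ _ hx'
      exact (Msg.encode_lt hN2 (hsize i) (hN u)).2.2.2.2
  rw [← hx]
  have h2 : 0 < Real.log 2 := Real.log_pos one_lt_two
  have h3 : 1 ≤ Real.log N / Real.log 2 := by
    rw [le_div_iff₀ h2, one_mul]
    exact Real.log_le_log two_pos (by exact_mod_cast hn.trans hnN)
  have h5 : 17 / Real.log 2 * Real.log N = 17 * (Real.log N / Real.log 2) := by ring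
  rw [h5]
  rcases Nat.eq_zero_or_pos x.encode with h0 | h0
  · rw [h0]; simp only [Nat.size_zero, Nat.cast_zero]; linarith
  · have h4 := size_le_log h0
    have h6 : Real.log x.encode ≤ 16 * Real.log N := by
      have : Real.log x.encode ≤ Real.log ((N : ℝ) ^ 16) :=
        Real.log_le_log (by exact_mod_cast h0) (by exact_mod_cast hlt.le)
      rwa [Real.log_pow] at this
    have h7 : Real.log x.encode / Real.log 2 ≤ 16 * (Real.log N / Real.log 2) := by
      rw [← mul_div_assoc]; gcongr
    linarith

end Time

end AsyncClique

namespace AsyncClique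

/-! ### The number of messages -/

section Count

variable {n : ℕ} {ids : Fin n → ℕ} {p : PortMapping n} {c c' : Config (captureElection n)}

/-- The total weight of the messages in transit. -/
def Config.load (c : Config (captureElection n)) (f : Msg → ℕ) : ℕ :=
  ∑ u, ∑ i, ((c.transit u i).map fun y => f (Msg.decode y.1)).sum

theorem sum_filter_fst {m : ℕ} (f : Msg → ℕ) (l : List (Fin m × Msg)) :
    ∑ i, ((l.filter fun x => x.1 = i).map fun x => f x.2).sum = (l.map fun x => f x.2).sum := by
  induction l with
  | nil => simp
  | cons x l ih =>
    have h : ∀ i, (((x :: l).filter fun x => x.1 = i).map fun x => f x.2).sum =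
        (if x.1 = i then f x.2 else 0) + ((l.filter fun x => x.1 = i).map fun x => f x.2).sum := by
      intro i
      by_cases hi : x.1 = i <;> simp [hi]
    simp only [h, Finset.sum_add_distrib, ih, List.map_cons, List.sum_cons]
    simp

theorem Config.load_act (c : Config (captureElection n)) (t : ℝ) (v : Fin n)
    (r : NodeState n × List (Fin (n - 1) × Msg)) (f : Msg → ℕ) :
    (c.act t v (encodeAll r)).load f = c.load f + (r.2.map fun x => f x.2).sum := by
  have h : ∀ u i, (((c.act t v (encodeAll r)).transit u i).map fun y => f (Msg.decode y.1)).sum =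
      ((c.transit u i).map fun y => f (Msg.decode y.1)).sum +
        if u = v then ((r.2.filter fun x => x.1 = i).map fun x => f x.2).sum else 0 := by
    intro u i
    by_cases huv : u = v
    · simp [Config.act, encodeAll, huv, List.filter_map, Function.comp_def]
    · simp [Config.act, huv]
  simp only [Config.load, h, Finset.sum_add_distrib]
  congr 1
  rw [Finset.sum_eq_single v]
  · simpa using sum_filter_fst f r.2
  · intro u _ hu; simp [hu]
  · simp

theorem Config.load_setTransit {c : Config (captureElection n)} {u : Fin n} {i : Fin (n - 1)}
    {m : ℕ} {s : ℝ} {rest : List (ℕ × ℝ)} (hm : c.transit u i = (m, s) :: rest) (f : Msg → ℕ) :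
    (c.setTransit u i rest).load f + f (Msg.decode m) = c.load f := by
  have h : ∀ v k, ((c.transit v k).map fun y => f (Msg.decode y.1)).sum =
      (((c.setTransit u i rest).transit v k).map fun y => f (Msg.decode y.1)).sum +
        if v = u then if k = i then f (Msg.decode m) else 0 else 0 := by
    intro v k
    by_cases hv : v = u
    · by_cases hk : k = i
      · subst hv hk; simp [Config.setTransit, hm, add_comm]
      · simp [Config.setTransit, hk]
    · simp [Config.setTransit, hv]
  simp only [Config.load, h, Finset.sum_add_distrib]
  simp

/-- The number of messages that the delivery of a message may still cause, while the receiver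
neither reaches a new level nor becomes the leader. -/
def Msg.weight : Msg → ℕ
  | request _ => 3
  | query _ => 2
  | release _ => 1
  | grant => 0
  | leader _ => 0

/-- The number of messages accounted for by the progress of a candidate. -/
def NodeState.budget (s : NodeState n) : ℕ :=
  4 * (Finset.univ.filter fun k : Fin (n - 1) => Nat.size k < s.level).card +
    if s.won then n - 1 else 0

/-- The number of messages in a list together with their weights. -/
def cost (ms : List (Fin (n - 1) × Msg)) : ℕ :=
  ms.length + (ms.map fun x => x.2.weight).sum

theorem NodeState.cost_announcements (s : NodeState n) : cost s.announcements = n - 1 := by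
  simp [cost, NodeState.announcements, Msg.weight, Function.comp_def]

theorem NodeState.cost_requests (s : NodeState n) :
    cost s.requests =
      4 * (Finset.univ.filter fun k : Fin (n - 1) => Nat.size k = s.level).card := by
  have : ((List.finRange (n - 1)).filter fun k : Fin (n - 1) => Nat.size k = s.level).length =
      (Finset.univ.filter fun k : Fin (n - 1) => Nat.size k = s.level).card := by
    rw [← List.toFinset_card_of_nodup ((List.nodup_finRange _).filter _)]
    congr 1
    ext k
    simp
  simp [cost, NodeState.requests, Msg.weight, Function.comp_def, this]
  omega

theorem card_size_lt_succ (m l : ℕ) :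
    (Finset.univ.filter fun k : Fin m => Nat.size k < l + 1).card =
      (Finset.univ.filter fun k : Fin m => Nat.size k < l).card +
        (Finset.univ.filter fun k : Fin m => Nat.size k = l).card := by
  rw [← Finset.card_union_of_disjoint]
  · congr 1
    ext k
    simp only [Finset.mem_filter, Finset.mem_univ, true_and, Finset.mem_union]
    omega
  · rw [Finset.disjoint_filter]
    intro k _ h
    omega

theorem NodeState.cost_advance {s : NodeState n} (hs : s.won = false) :
    cost s.advance.2 + s.budget ≤ s.advance.1.budget := by
  unfold advance
  split_ifs with h
  · simp [NodeState.cost_announcements, budget, win, hs]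
    omega
  · simp only [NodeState.cost_requests, budget, card_size_lt_succ]
    omega

/-- The weight of a message decreases along request, query, release, grant and pays for the reply.
Only moving up or winning creates new cost, and this raises the budget. -/
theorem NodeState.cost_react (s : NodeState n) (j : Fin (n - 1)) (x : Msg) :
    cost (s.react j x).2 + s.budget ≤ x.weight + (s.react j x).1.budget := by
  have h := s.reacts j x
  cases x with
  | grant =>
    unfold react
    simp only [Msg.weight]
    split_ifs with h
    · simp [cost, budget]
    · push Not at h
      have := NodeState.cost_advance (s := { s with got := insert j s.got }) (by simpa using h.2.1)
      simpa [budget] using this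
  | _ =>
    generalize (s.react j _).1 = st at *
    generalize (s.react j _).2 = ms at *
    cases h <;> simp [cost, budget, Msg.weight]

theorem sum_update_add {f : NodeState n → ℕ} (g : Fin n → NodeState n) (v : Fin n)
    (st : NodeState n) :
    ∑ u, f (Function.update g v st u) + f (g v) = ∑ u, f (g u) + f st := by
  rw [← Finset.add_sum_erase _ _ (Finset.mem_univ v),
    ← Finset.add_sum_erase (a := v) Finset.univ (fun u => f (g u)) (Finset.mem_univ v)]
  have : ∑ u ∈ Finset.univ.erase v, f (Function.update g v st u) =
      ∑ u ∈ Finset.univ.erase v, f (g u) :=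
    Finset.sum_congr rfl fun u hu => by rw [Function.update_of_ne (Finset.ne_of_mem_erase hu)]
  rw [this, Function.update_self]
  omega

/-- Amortisation: the weights in transit are the potential, so every event preserves the inequality.
-/
theorem Reachable.sent_le_budget {c : Config (captureElection n)} (hc : Reachable ids p c) :
    c.sent + c.load Msg.weight ≤ ∑ u, (c.node u).budget := by
  induction hc with
  | refl => simp [Config.initial, Config.load]
  | tail hb hs ih =>
    rename_i c c'
    cases hs with
    | wake t v ht hv =>
      have h1 := Config.load_act c t v (c.node v).advance Msg.weight
      have h2 := sum_update_add (f := NodeState.budget) c.node v (c.node v).advance.1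
      have h3 := NodeState.cost_advance (s := c.node v)
        (by rw [(Reachable.safe hb).asleep v hv]; rfl)
      have h4 : (c.act t v (encodeAll (c.node v).advance)).sent =
        c.sent + (c.node v).advance.2.length := by simp [Config.act, encodeAll]
      change (c.act t v (encodeAll (c.node v).advance)).sent +
        (c.act t v (encodeAll (c.node v).advance)).load Msg.weight ≤
        ∑ u, (Function.update c.node v (c.node v).advance.1 u).budget
      simp only [cost] at h3
      omega
    | deliver t u i m s rest ht hm =>
      generalize hv : p.toFun (u, i) = vj
      obtain ⟨v, j⟩ := vj
      simp only
      have h0 := Config.load_setTransit hm Msg.weight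
      have h1 := Config.load_act (c.setTransit u i rest) t v ((c.node v).react j (Msg.decode m))
        Msg.weight
      have h2 := sum_update_add (f := NodeState.budget) c.node v
        ((c.node v).react j (Msg.decode m)).1
      have h3 := NodeState.cost_react (c.node v) j (Msg.decode m)
      have h4 : ((c.setTransit u i rest).act t v
        (encodeAll ((c.node v).react j (Msg.decode m)))).sent =
        c.sent + ((c.node v).react j (Msg.decode m)).2.length := by
        simp [Config.act, encodeAll, Config.setTransit]
      change ((c.setTransit u i rest).act t v
          (encodeAll ((c.node v).react j (Msg.decode m)))).sent +
        ((c.setTransit u i rest).act t v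
          (encodeAll ((c.node v).react j (Msg.decode m)))).load Msg.weight ≤
        ∑ w, (Function.update c.node v ((c.node v).react j (Msg.decode m)).1 w).budget
      simp only [cost] at h3
      omega

/-! ### Counting the candidates that reach a given level -/

theorem card_size_lt {m : ℕ} (k : Fin m) :
    (k : ℕ) + 1 ≤ 2 * (Finset.univ.filter fun i : Fin m => Nat.size i < Nat.size k).card ∨
      (k : ℕ) = 0 := by
  rcases Nat.eq_zero_or_pos (k : ℕ) with h | h
  · exact .inr h
  left
  obtain ⟨l, hl⟩ : ∃ l, Nat.size k = l + 1 := ⟨Nat.size k - 1, by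
    have := Nat.size_pos.2 h; omega⟩
  have h1 : 2 ^ l ≤ (k : ℕ) := Nat.lt_size.1 (by omega)
  have h2 : (k : ℕ) < 2 ^ (l + 1) := Nat.size_le.1 hl.le
  -- The ports below `2 ^ l` all qualify, and `k + 1 ≤ 2 ^ (l + 1)`.
  have h3 : 2 ^ l ≤ (Finset.univ.filter fun i : Fin m => Nat.size i < Nat.size k).card := by
    calc 2 ^ l = (Finset.univ : Finset (Fin (2 ^ l))).card := by simp
      _ = (Finset.univ.map (Fin.castLEEmb (h1.trans k.isLt.le))).card := by simp
      _ ≤ _ := Finset.card_le_card fun i hi => by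
        obtain ⟨a, -, rfl⟩ := Finset.mem_map.1 hi
        simp only [Finset.mem_filter, Finset.mem_univ, true_and, hl]
        exact Nat.lt_succ_of_le (Nat.size_le.2 a.isLt)
  rw [pow_succ] at h2
  omega

/-- Few candidates reach the level at which the node at port `k` is requested, since they have
captured pairwise distinct nodes. -/
theorem Safe.card_level (h : Safe ids p c) (k : Fin (n - 1)) :
    (Finset.univ.filter fun a => Nat.size k < (c.node a).level).card * ((k : ℕ) + 1) ≤ 2 * n := by
  rcases card_size_lt k with hk | hk
  · have key : (Finset.univ.filter fun a => Nat.size k < (c.node a).level).card *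
        (Finset.univ.filter fun i : Fin (n - 1) => Nat.size i < Nat.size k).card ≤ n := by
      rw [← Finset.card_product]
      conv_rhs => rw [← Finset.card_fin n]
      -- Pairs (candidate, captured port) are mapped to captured nodes. Were a node hit through two
      -- different ports, `exclusive` would stop one candidate at level at most `Nat.size k`.
      refine Finset.card_le_card_of_injOn (fun x => (p.toFun x).1) (fun _ _ => Finset.mem_univ _) ?_
      rintro ⟨a, i⟩ hx ⟨b, j⟩ hy hxy
      simp only [Finset.coe_product, Finset.coe_filter, Finset.mem_univ, true_and, Set.mem_prod,
        Set.mem_ofPred_eq] at hx hy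
      obtain ⟨⟨v, l⟩, hv⟩ : ∃ x, p.toFun (a, i) = x := ⟨_, rfl⟩
      obtain ⟨⟨w, l'⟩, hw⟩ : ∃ x, p.toFun (b, j) = x := ⟨_, rfl⟩
      simp only [hv, hw] at hxy
      subst hxy
      by_cases hl : l = l'
      · subst hl
        exact p.involutive.injective (hv.trans hw.symm)
      · have h1 := h.got_granted a i v l hv (h.got_of_level a i (by omega))
        have h2 := h.got_granted b j v l' hw (h.got_of_level b j (by omega))
        rcases h.exclusive v l a i l' b j (p.symm hv) (p.symm hw) hl h1 h2 with h3 | h3 <;> omega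
    nlinarith
  · have := Finset.card_le_univ (Finset.univ.filter fun a => Nat.size k < (c.node a).level)
    rw [Fintype.card_fin] at this
    have h1 : (k : ℕ) + 1 = 1 := by omega
    rw [h1]
    omega

/-- Double counting of pairs (candidate, requested port) by ports, with `card_level` for each port;
at most one winner pays for announcements. -/
theorem Safe.sum_budget_le (h : Safe ids p c) :
    ((∑ u, (c.node u).budget : ℕ) : ℝ) ≤ 8 * n * harmonic (n - 1) + (n - 1 : ℕ) := by
  have h1 : ∑ u, (Finset.univ.filter fun k : Fin (n - 1) => Nat.size k < (c.node u).level).card =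
      ∑ k : Fin (n - 1), (Finset.univ.filter fun a => Nat.size k < (c.node a).level).card := by
    simp only [Finset.card_filter]
    exact Finset.sum_comm
  have h2 : ∑ u, (if (c.node u).won then n - 1 else 0) ≤ n - 1 := by
    rw [← Finset.sum_filter, Finset.sum_const, smul_eq_mul]
    have : (Finset.univ.filter fun u => (c.node u).won = true).card ≤ 1 :=
      Finset.card_le_one.2 fun a ha b hb =>
        h.won_unique a b (Finset.mem_filter.1 ha).2 (Finset.mem_filter.1 hb).2
    nlinarith
  have h3 : ((∑ k : Fin (n - 1),
      (Finset.univ.filter fun a => Nat.size k < (c.node a).level).card : ℕ) : ℝ) ≤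
      2 * n * harmonic (n - 1) := by
    rw [harmonic, ← Fin.sum_univ_eq_sum_range (fun i => ((i + 1 : ℕ) : ℚ)⁻¹)]
    push_cast
    rw [Finset.mul_sum]
    refine Finset.sum_le_sum fun k _ => ?_
    rw [← div_eq_mul_inv, le_div_iff₀ (by positivity)]
    exact_mod_cast h.card_level k
  simp only [NodeState.budget, Finset.sum_add_distrib, ← Finset.mul_sum, h1]
  push_cast at h2 h3 ⊢
  have h2' : (∑ u, (if (c.node u).won then ((n - 1 : ℕ) : ℝ) else 0)) ≤ (n - 1 : ℕ) := by
    exact_mod_cast h2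
  linarith

theorem Reachable.sent_le {c : Config (captureElection n)} (hc : Reachable ids p c) :
    (c.sent : ℝ) ≤ 8 * n * harmonic (n - 1) + (n - 1 : ℕ) := by
  refine le_trans ?_ hc.safe.sum_budget_le
  exact_mod_cast (Nat.le_add_right _ _).trans hc.sent_le_budget

theorem messagesAtMost (hn : 1 ≤ n) :
    MessagesAtMost (captureElection n) ids p (17 / Real.log 2 * (n * Real.log n)) := by
  intro c hc
  refine hc.sent_le.trans ?_
  rcases hn.eq_or_lt with rfl | hn
  · simp
  have h2 : 0 < Real.log 2 := Real.log_pos one_lt_two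
  have h2' : Real.log 2 ≤ 1 := by linarith [Real.log_two_lt_d9]
  have h0 : 0 ≤ Real.log n := Real.log_nonneg (by exact_mod_cast hn.le)
  have h3 : 1 ≤ Real.log n / Real.log 2 := by
    rw [le_div_iff₀ h2, one_mul]
    exact Real.log_le_log two_pos (by exact_mod_cast hn)
  have h4 : Real.log n ≤ Real.log n / Real.log 2 := by
    rw [le_div_iff₀ h2]
    nlinarith
  have h5 : (harmonic (n - 1) : ℝ) ≤ 1 + Real.log n := by
    refine (harmonic_le_one_add_log (n - 1)).trans ?_
    gcongr
    · exact_mod_cast (by omega : 0 < n - 1)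
    · omega
  have h6 : ((n - 1 : ℕ) : ℝ) ≤ n := by exact_mod_cast Nat.sub_le n 1
  have h7 : 17 / Real.log 2 * (n * Real.log n) = n * (17 * (Real.log n / Real.log 2)) := by ring
  have hn0 : (0 : ℝ) ≤ n := Nat.cast_nonneg n
  rw [h7]
  calc 8 * n * (harmonic (n - 1) : ℝ) + ((n - 1 : ℕ) : ℝ)
      ≤ 8 * n * (1 + Real.log n) + n := by gcongr
    _ = n * (9 + 8 * Real.log n) := by ring
    _ ≤ n * (17 * (Real.log n / Real.log 2)) := by
      gcongr
      linarith

/-! ### Termination -/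

/-- The number of events so far. -/
def Config.progress (c : Config (captureElection n)) : ℤ :=
  (Finset.univ.filter fun u => c.awake u = true).card + c.sent - c.load fun _ => 1

/-- New messages enter both `sent` and the load and cancel; what remains is the newly awake node or
the delivered message. -/
theorem Step.progress_lt (h : Step p c c') : c.progress + 1 ≤ c'.progress := by
  cases h with
  | wake t v ht hv =>
    have h1 := Config.load_act c t v (c.node v).advance fun _ => 1
    have h2 : (Finset.univ.filter fun u => Function.update c.awake v true u = true) =
        insert v (Finset.univ.filter fun u => c.awake u = true) := by
      ext u
      by_cases hu : u = v <;> simp [Function.update_apply, hu]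
    have h3 : v ∉ Finset.univ.filter fun u => c.awake u = true := by simp [hv]
    change _ ≤ ((Finset.univ.filter fun u => Function.update c.awake v true u = true).card : ℤ) +
      (c.sent + (encodeAll (c.node v).advance).2.length : ℕ) -
      ((c.act t v (encodeAll (c.node v).advance)).load fun _ => 1 : ℕ)
    rw [h1, h2, Finset.card_insert_of_notMem h3]
    simp [Config.progress, encodeAll]
    omega
  | deliver t u i m s rest ht hm =>
    generalize hv : p.toFun (u, i) = vj
    obtain ⟨v, j⟩ := vj
    have h0 := Config.load_setTransit hm fun _ => 1
    have h1 := Config.load_act (c.setTransit u i rest) t v ((c.node v).react j (Msg.decode m))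
      fun _ => 1
    have h2 : (Finset.univ.filter fun u => c.awake u = true).card ≤
        (Finset.univ.filter fun u => Function.update c.awake v true u = true).card := by
      refine Finset.card_le_card fun u hu => ?_
      by_cases huv : u = v <;> simp_all [Function.update_apply]
    change _ ≤ ((Finset.univ.filter fun u => Function.update c.awake v true u = true).card : ℤ) +
      (c.sent + (encodeAll ((c.node v).react j (Msg.decode m))).2.length : ℕ) -
      (((c.setTransit u i rest).act t v
        (encodeAll ((c.node v).react j (Msg.decode m)))).load fun _ => 1 : ℕ)
    rw [h1]
    simp [Config.progress, encodeAll]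
    omega

theorem not_infinite (ids : Fin n → ℕ) (p : PortMapping n) :
    ¬ ∃ e : ℕ → Config (captureElection n), e 0 = Config.initial _ ids ∧
      ∀ k, Step p (e k) (e (k + 1)) := by
  rintro ⟨e, h0, hs⟩
  have hr : ∀ k, Reachable ids p (e k) := by
    intro k
    induction k with
    | zero => rw [h0]; exact .refl
    | succ k ih => exact .tail ih (hs k)
  have hk : ∀ k : ℕ, (k : ℤ) ≤ (e k).progress := by
    intro k
    induction k with
    | zero => rw [h0]; simp [Config.progress, Config.initial, Config.load]
    | succ k ih => push_cast; exact (by omega : (k : ℤ) + 1 ≤ _).trans (hs k).progress_lt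
  -- Progress never exceeds `n` wake-ups plus `M` messages, so `n + M + 1` events are impossible.
  obtain ⟨M, hM⟩ := exists_nat_ge (8 * n * (harmonic (n - 1) : ℝ) + (n - 1 : ℕ))
  have h1 : (e (n + M + 1)).sent ≤ M := by exact_mod_cast (hr _).sent_le.trans hM
  have h2 := hk (n + M + 1)
  have h3 := Finset.card_le_univ (Finset.univ.filter fun u => (e (n + M + 1)).awake u = true)
  rw [Fintype.card_fin] at h3
  simp only [Config.progress] at h2
  push_cast at h2
  omega

theorem electsLeader (hinj : Function.Injective ids) (p : PortMapping n) :
    ElectsLeader (captureElection n) ids p := by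
  refine ⟨not_infinite ids p, fun c c' hc hs u l hl => ?_, fun c hc hq => hc.elected hinj hq⟩
  have hl' : (c.node u).output = some l := hl
  have e : Event p c c' := hs.event (Reachable.encoded hc) (Reachable.lastWake_le hc)
  exact ((Reachable.safe hc).grows e u).output l hl'

end Count

end AsyncClique

theorem mainTheorem8 :
    ∃ (A : (n : ℕ) → AsyncClique.Algorithm n) (C : ℝ),
      ∀ (n : ℕ), 1 ≤ n → ∀ (ids : Fin n → ℕ), Function.Injective ids →
      ∀ (p : AsyncClique.PortMapping n),
        AsyncClique.ElectsLeader (A n) ids p ∧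
        AsyncClique.TimeAtMost (A n) ids p (C * Real.log n) ∧
        AsyncClique.MessagesAtMost (A n) ids p (C * (n * Real.log n)) ∧
        ∀ N : ℕ, (∀ u, ids u < N) →
          AsyncClique.MessageBitsAtMost (A n) ids p (C * Real.log N) := by
  -- The constant 17 comes from `8 + 9` in the message count and `16 + 1` in the message size; the
  -- time bound needs only 13.
  refine ⟨AsyncClique.captureElection, 17 / Real.log 2, fun n hn ids hinj p =>
    ⟨AsyncClique.electsLeader hinj p, fun c hc => ?_, AsyncClique.messagesAtMost hn,
      fun N hN => AsyncClique.messageBitsAtMost hinj hN⟩⟩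
  refine (AsyncClique.timeAtMost hn c hc).trans ?_
  have h2 : 0 < Real.log 2 := Real.log_pos one_lt_two
  have h0 : 0 ≤ Real.log n := Real.log_nonneg (by exact_mod_cast hn)
  gcongr
  norm_num
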